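/- Let $n\ge 4$, $c\in\{-1,0,1\}$, let $\mathbb{Q}^n(c)$ be a simply connected, complete $n$-dimensional Riemannian manifold of constant sectional curvature $c$ with metric $g_{\mathbb{Q}}$, let $I\subseteq\mathbb{R}$ be an open interval and $f:I\to(0,\infty)$ a smooth function. Let $I\times_f\mathbb{Q}^n(c)$ be the product $I\times\mathbb{Q}^n(c)$ with the metric $dt^2+f(t)^2g_{\mathbb{Q}}$, and suppose that its sectional curvature is not constant on any nonempty open subset. Let $(M^n,g)$ be a connected Riemannian manifold and $\chi:M\to I\times_f\mathbb{Q}^n(c)$ a smooth isometric immersion. Suppose that $M$ is Einstein, i.e. $\mathrm{Ric}=\rho g$ for a constant $\rho$, and that $\chi$ is totally umbilical, i.e. at every point the shape operator associated with a unit normal vector is a multiple of the identity. Then $M$ is a slice: the component $T$ of $\partial_t$ tangent to $M$ vanishes identically, and there is $t_0\in I$ such that $\chi(M)\subseteq\{t_0\}\times\mathbb{Q}^n(c)$ and $\chi$ is a local isometry (and local diffeomorphism) from $M$ into $\{t_0\}\times\mathbb{Q}^n(c)$ with the induced metric $f(t_0)^2g_{\mathbb{Q}}$. If $M$ is moreover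 complete, then $\chi$ is an isometry of $M$ onto $\{t_0\}\times\mathbb{Q}^n(c)$. -/

import Mathlib

open scoped Manifold ContDiff Bundle

noncomputable section

/-! ### Curvature in charts

In Mathlib the tangent space `TangentSpace I x` of a manifold modelled on the vector space `E`
is `E` itself, identified with the tangent space at `x` through the preferred chart at `x`.
A (not necessarily smooth) field of bilinear forms on a manifold `X` is therefore a function
`X → E →L[ℝ] E →L[ℝ] ℝ`. -/

section Local

variable {E : Type*} [NormedAddCommGroup E] [NormedSpace ℝ E]

/-- Christoffel symbols (of the second kind) of a metric `G` given in coordinates: the vector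
`Γ(v, w)` for which `G(Γ(v, w), z) = ½ (∂_v G(w, z) + ∂_w G(v, z) - ∂_z G(v, w))` for all `z`. In
coordinates, `∇_v W = ∂_v W + Γ(v, W)`. -/
def christoffel (G : E → E →L[ℝ] E →L[ℝ] ℝ) (y v w : E) : E :=
  (G y).inverse ((1 / 2 : ℝ) •
    (fderiv ℝ G y v w + fderiv ℝ G y w v - ((fderiv ℝ G y).flip v).flip w))

/-- Curvature operator `R(u, v) w = ∇_u ∇_v w - ∇_v ∇_u w - ∇_[u, v] w` of a metric given in
coordinates, computed on the constant vector fields `u`, `v`, `w`. -/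
def coordCurvature (G : E → E →L[ℝ] E →L[ℝ] ℝ) (y u v w : E) : E :=
  fderiv ℝ (fun z => christoffel G z v w) y u - fderiv ℝ (fun z => christoffel G z u w) y v
    + christoffel G y u (christoffel G y v w) - christoffel G y v (christoffel G y u w)

end Local

section Manifold

variable {E : Type*} [NormedAddCommGroup E] [NormedSpace ℝ E]
  {H : Type*} [TopologicalSpace H] (I : ModelWithCorners ℝ E H)
  {X : Type*} [TopologicalSpace X] [ChartedSpace H X]

/-- The differential at `y` of the inverse of the preferred chart at `p`. -/
def chartFrame (p : X) (y : E) : E →L[ℝ] E :=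
  mfderiv 𝓘(ℝ, E) I (extChartAt I p).symm y

/-- Coordinate expression of a metric `g` in the preferred chart at `p`. -/
def chartMetric (g : X → E →L[ℝ] E →L[ℝ] ℝ) (p : X) (y : E) : E →L[ℝ] E →L[ℝ] ℝ :=
  (g ((extChartAt I p).symm y)).bilinearComp (chartFrame I p y) (chartFrame I p y)

/-- The curvature operator `R(u, v) w` of the metric `g` at the point `p`. -/
def curvatureAt (g : X → E →L[ℝ] E →L[ℝ] ℝ) (p : X) (u v w : E) : E :=
  coordCurvature (chartMetric I g p) (extChartAt I p p) u v w

/-- The sectional curvature at `p` of the plane spanned by the independent vectors `u`, `v`. -/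
def sectionalCurvature (g : X → E →L[ℝ] E →L[ℝ] ℝ) (p : X) (u v : E) : ℝ :=
  g p (curvatureAt I g p u v v) u / (g p u u * g p v v - g p u v ^ 2)

/-- On the set `W`, all planes have sectional curvature `κ`. -/
def HasConstantCurvatureOn (g : X → E →L[ℝ] E →L[ℝ] ℝ) (κ : ℝ) (W : Set X) : Prop :=
  ∀ p ∈ W, ∀ u v : E, LinearIndependent ℝ ![u, v] → sectionalCurvature I g p u v = κ

end Manifold

section Ricci

variable {n : ℕ} {X : Type*} [TopologicalSpace X] [ChartedSpace (EuclideanSpace ℝ (Fin n)) X]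

/-- The Ricci curvature `Ric(u, v) = trace (w ↦ R(w, u) v)` at `p`. -/
def ricciCurvature
    (g : X → EuclideanSpace ℝ (Fin n) →L[ℝ] EuclideanSpace ℝ (Fin n) →L[ℝ] ℝ) (p : X)
    (u v : EuclideanSpace ℝ (Fin n)) : ℝ :=
  ∑ i : Fin n, curvatureAt (𝓡 n) g p (EuclideanSpace.single i 1) u v i

/-- Einstein metrics: `Ric = ρ g` for a constant `ρ`. -/
def IsEinstein
    (g : X → EuclideanSpace ℝ (Fin n) →L[ℝ] EuclideanSpace ℝ (Fin n) →L[ℝ] ℝ) : Prop :=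
  ∃ ρ : ℝ, ∀ (p : X) (u v : EuclideanSpace ℝ (Fin n)), ricciCurvature g p u v = ρ * g p u v

/-- The metric carried by a Riemannian manifold in the sense of Mathlib. -/
def riemannianMetricOf (n : ℕ) (X : Type*) [TopologicalSpace X]
    [ChartedSpace (EuclideanSpace ℝ (Fin n)) X]
    [Bundle.RiemannianBundle (fun x : X => TangentSpace (𝓡 n) x)] (x : X) :
    EuclideanSpace ℝ (Fin n) →L[ℝ] EuclideanSpace ℝ (Fin n) →L[ℝ] ℝ :=
  (Bundle.RiemannianBundle.g (E := fun x : X => TangentSpace (𝓡 n) x)).inner x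

/-! ### Warped products and their hypersurfaces -/

/-- The warped product metric `dt² + f(t)² g` on `ℝ × X`; it is a Riemannian metric on the part
`J × X` that lies over an open interval `J` on which `f` is smooth and positive, and this part is
the warped product `J ×_f X`. -/
def warpedMetric (f : ℝ → ℝ)
    (g : X → EuclideanSpace ℝ (Fin n) →L[ℝ] EuclideanSpace ℝ (Fin n) →L[ℝ] ℝ) (q : ℝ × X) :
    (ℝ × EuclideanSpace ℝ (Fin n)) →L[ℝ] (ℝ × EuclideanSpace ℝ (Fin n)) →L[ℝ] ℝ :=
  (ContinuousLinearMap.mul ℝ ℝ).bilinearComp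
      (ContinuousLinearMap.fst ℝ ℝ (EuclideanSpace ℝ (Fin n)))
      (ContinuousLinearMap.fst ℝ ℝ (EuclideanSpace ℝ (Fin n)))
    + f q.1 ^ 2 • (g q.2).bilinearComp
      (ContinuousLinearMap.snd ℝ ℝ (EuclideanSpace ℝ (Fin n)))
      (ContinuousLinearMap.snd ℝ ℝ (EuclideanSpace ℝ (Fin n)))

variable {M : Type*} [TopologicalSpace M] [ChartedSpace (EuclideanSpace ℝ (Fin n)) M]

/-- The differential of a map `χ : M → ℝ × X`. -/
def differential (χ : M → ℝ × X) (p : M) :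
    EuclideanSpace ℝ (Fin n) →L[ℝ] ℝ × EuclideanSpace ℝ (Fin n) :=
  mfderiv (𝓡 n) (𝓘(ℝ, ℝ).prod (𝓡 n)) χ p

/-- The second derivative `∇̄_u (dχ v)` at `p` of a map `χ` into `ℝ × X` with the metric `h`, where
`v` is extended to a field which is constant in the preferred chart at `p`; in coordinates it is
`∂_u ∂_v χ + Γ(∂_u χ, ∂_v χ)`. -/
def secondDerivative
    (h : ℝ × X → (ℝ × EuclideanSpace ℝ (Fin n)) →L[ℝ] (ℝ × EuclideanSpace ℝ (Fin n)) →L[ℝ] ℝ)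
    (χ : M → ℝ × X) (p : M) (u v : EuclideanSpace ℝ (Fin n)) : ℝ × EuclideanSpace ℝ (Fin n) :=
  fderiv ℝ (fderiv ℝ (writtenInExtChartAt (𝓡 n) (𝓘(ℝ, ℝ).prod (𝓡 n)) p χ))
      (extChartAt (𝓡 n) p p) u v
    + christoffel (chartMetric (𝓘(ℝ, ℝ).prod (𝓡 n)) h (χ p))
      (extChartAt (𝓘(ℝ, ℝ).prod (𝓡 n)) (χ p) (χ p))
      (differential χ p u) (differential χ p v)

/-- `ν` is a unit normal vector at `p` of the immersion `χ` into `ℝ × X` with the metric `h`. -/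
def IsUnitNormal
    (h : ℝ × X → (ℝ × EuclideanSpace ℝ (Fin n)) →L[ℝ] (ℝ × EuclideanSpace ℝ (Fin n)) →L[ℝ] ℝ)
    (χ : M → ℝ × X) (p : M) (ν : ℝ × EuclideanSpace ℝ (Fin n)) : Prop :=
  h (χ p) ν ν = 1 ∧ ∀ u : EuclideanSpace ℝ (Fin n), h (χ p) (differential χ p u) ν = 0

/-- `A` is the shape operator at `p` associated with the unit normal vector `ν`:
`g(A u, v) = h(∇̄_u (dχ v), ν)`. -/
def IsShapeOperator
    (g : M → EuclideanSpace ℝ (Fin n) →L[ℝ] EuclideanSpace ℝ (Fin n) →L[ℝ] ℝ)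
    (h : ℝ × X → (ℝ × EuclideanSpace ℝ (Fin n)) →L[ℝ] (ℝ × EuclideanSpace ℝ (Fin n)) →L[ℝ] ℝ)
    (χ : M → ℝ × X) (p : M) (ν : ℝ × EuclideanSpace ℝ (Fin n))
    (A : EuclideanSpace ℝ (Fin n) →L[ℝ] EuclideanSpace ℝ (Fin n)) : Prop :=
  ∀ u v : EuclideanSpace ℝ (Fin n), g p (A u) v = h (χ p) (secondDerivative h χ p u v) ν

/-- Totally umbilical hypersurfaces: for every unit normal vector at a point, the shape operator
is a multiple of the identity. -/
def IsTotallyUmbilical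
    (g : M → EuclideanSpace ℝ (Fin n) →L[ℝ] EuclideanSpace ℝ (Fin n) →L[ℝ] ℝ)
    (h : ℝ × X → (ℝ × EuclideanSpace ℝ (Fin n)) →L[ℝ] (ℝ × EuclideanSpace ℝ (Fin n)) →L[ℝ] ℝ)
    (χ : M → ℝ × X) : Prop :=
  ∀ (p : M) (ν : ℝ × EuclideanSpace ℝ (Fin n)), IsUnitNormal h χ p ν →
    ∃ μ : ℝ, IsShapeOperator g h χ p ν
      (μ • ContinuousLinearMap.id ℝ (EuclideanSpace ℝ (Fin n)))

/-- `χ` is an isometric immersion of `(M, g)` into `J × X` with the metric `h`. -/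
structure IsIsometricImmersion
    (g : M → EuclideanSpace ℝ (Fin n) →L[ℝ] EuclideanSpace ℝ (Fin n) →L[ℝ] ℝ)
    (h : ℝ × X → (ℝ × EuclideanSpace ℝ (Fin n)) →L[ℝ] (ℝ × EuclideanSpace ℝ (Fin n)) →L[ℝ] ℝ)
    (J : Set ℝ) (χ : M → ℝ × X) : Prop where
  smooth : ContMDiff (𝓡 n) (𝓘(ℝ, ℝ).prod (𝓡 n)) ∞ χ
  mem : ∀ p, (χ p).1 ∈ J
  isometric : ∀ (p : M) (u v : EuclideanSpace ℝ (Fin n)),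
    h (χ p) (differential χ p u) (differential χ p v) = g p u v

/-- The tangential part `T` of `∂_t` along the isometric immersion `χ`: the tangent vector with
`g(T, u) = h(∂_t, dχ u)` for all `u`, so that `∂_t - dχ T` is normal. -/
def tangentialPart
    (g : M → EuclideanSpace ℝ (Fin n) →L[ℝ] EuclideanSpace ℝ (Fin n) →L[ℝ] ℝ)
    (h : ℝ × X → (ℝ × EuclideanSpace ℝ (Fin n)) →L[ℝ] (ℝ × EuclideanSpace ℝ (Fin n)) →L[ℝ] ℝ)
    (χ : M → ℝ × X) (p : M) : EuclideanSpace ℝ (Fin n) :=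
  (g p).inverse ((h (χ p) (1, 0)).comp (differential χ p))

end Ricci

end

/-!
Let `kt = (c - f'²) / f²` and `kr = -f'' / f` be the curvatures of the warped product on planes
tangent to the slices and on planes containing `∂_t`; for an arbitrary plane spanned by `U`, `V`
the curvature form is `kt` times the Gram determinant of `U`, `V` plus `kr - kt` times a term of
rank one in `dt` (`IsRiemannianMetric.curvature_warped`). At an umbilical point with principal
curvature `μ`, the Gauss equation adds `μ²` times the Gram determinant
(`IsIsometricImmersion.exists_curvature_eq`). Taking the trace, the Ricci curvature of the
hypersurface is
`Ric(v, v) = S g(v, v) + (kr - kt) (n - 2) dt(v)²`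
for a number `S` which depends on the point only (`trace_eq_of_forall`). A tangent vector `v ≠ 0`
with `dt(v) = 0` shows that the Einstein constant is `S`, so `dt` vanishes on the tangent space
wherever `kr ≠ kt` (`IsIsometricImmersion.differential_fst_eq_zero`).

If `dt` did not vanish at some point of `M`, the heights of the points nearby would fill an
interval, and `kr = kt` there. Since `kt' = 2 f' (kr - kt) / f`, the function `kt` would be constant
on this interval, and the curvature of the warped product would be constant on an open set
(`IsRiemannianMetric.exists_hasConstantCurvatureOn_warped`), which is excluded. So `dt` vanishes
along the hypersurface, the height is constant, and the projection `M → Q` is a local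
diffeomorphism which multiplies the metric by a constant.

When `M` is complete, paths of bounded speed lift through this projection, as their lifts are
Lipschitz (`IsLocalHomeomorph.exists_lift_of_lipschitz`). Lifting the straight segments of a chart
gives sections over small balls (`exists_section_of_complete`), so the projection is a covering,
and a connected covering of the simply connected `Q` has one sheet.

The Gauss equation and the curvature of warped products are first computed in coordinates, for
the Christoffel symbols of a field `G` of bilinear forms on a vector space. For a field of
bilinear forms on a manifold, `IsRiemannianMetric` says that it is a metric with smooth coordinate
expressions, which is what Mathlib's notion of a Riemannian metric provides
(`isRiemannianMetric_riemannianMetricOf`).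
-/

/-! ### Metrics in coordinates and the Gauss equation -/

section

set_option maxSynthPendingDepth 3

-- Instance search tries these instances, at great cost, on every space of linear maps.
attribute [-instance]
  Bundle.instNormedAddCommGroupOfRiemannianBundleOfIsTopologicalAddGroupOfContinuousConstSMulReal
  Bundle.instInnerProductSpaceReal

open Filter Topology ContinuousLinearMap

section CoordinateMetric

variable {E : Type*} [NormedAddCommGroup E] [NormedSpace ℝ E]
  {E' : Type*} [NormedAddCommGroup E'] [NormedSpace ℝ E']

/-- A Riemannian metric in coordinates, near the point `y`. Class `C²` is what the curvature
needs. -/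
structure IsMetricNear (G : E → E →L[ℝ] E →L[ℝ] ℝ) (y : E) : Prop where
  contDiffAt : ContDiffAt ℝ 2 G y
  symm : ∀ᶠ z in 𝓝 y, ∀ v w, G z v w = G z w v
  pos : ∀ᶠ z in 𝓝 y, ∀ v, v ≠ 0 → 0 < G z v v

/-- The Christoffel symbols as a field of continuous bilinear maps. -/
noncomputable def christoffelL (G : E → E →L[ℝ] E →L[ℝ] ℝ) (y : E) : E →L[ℝ] E →L[ℝ] E :=
  (compL ℝ E (E →L[ℝ] ℝ) E (G y).inverse) ∘L ((1 / 2 : ℝ) •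
    (fderiv ℝ G y + (fderiv ℝ G y).flip
      - ((flipₗᵢ ℝ E E ℝ : (E →L[ℝ] E →L[ℝ] ℝ) →L[ℝ] E →L[ℝ] E →L[ℝ] ℝ) ∘L (fderiv ℝ G y).flip)))

theorem christoffelL_apply (G : E → E →L[ℝ] E →L[ℝ] ℝ) (y v w : E) :
    christoffelL G y v w = christoffel G y v w := rfl

theorem IsMetricNear.eventually {G : E → E →L[ℝ] E →L[ℝ] ℝ} {y : E} (h : IsMetricNear G y) :
    ∀ᶠ z in 𝓝 y, IsMetricNear G z := by
  filter_upwards [h.contDiffAt.eventually (by decide), h.symm.eventually_nhds,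
    h.pos.eventually_nhds] with z h1 h2 h3 using ⟨h1, h2, h3⟩

/-- A definite bilinear form identifies a finite-dimensional space with its dual, so that the
`inverse` in the definition of the Christoffel symbols is a true inverse. -/
theorem isInvertible_of_pos [FiniteDimensional ℝ E] {B : E →L[ℝ] E →L[ℝ] ℝ}
    (hB : ∀ v, v ≠ 0 → 0 < B v v) : B.IsInvertible := by
  have hinj : Function.Injective (((ContinuousLinearMap.coeLM ℝ :
      (E →L[ℝ] ℝ) →ₗ[ℝ] (E →ₗ[ℝ] ℝ))) ∘ₗ (B : E →ₗ[ℝ] E →L[ℝ] ℝ)) := by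
    rw [← LinearMap.ker_eq_bot, LinearMap.ker_eq_bot']
    intro v hv
    by_contra hne
    have := congrArg (fun l : E →ₗ[ℝ] ℝ => l v) hv
    exact (hB v hne).ne' (by simpa using this)
  have hfin : Module.finrank ℝ E = Module.finrank ℝ (E →L[ℝ] ℝ) := by
    rw [(LinearMap.toContinuousLinearMap (𝕜 := ℝ) (E := E) (F' := ℝ)).symm.finrank_eq]
    exact (Subspace.dual_finrank_eq (K := ℝ) (V := E)).symm
  have hinj' : Function.Injective (B : E →ₗ[ℝ] E →L[ℝ] ℝ) := by
    intro v w hvw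
    apply hinj
    simp only [LinearMap.comp_apply]
    rw [hvw]
  refine ⟨(LinearEquiv.ofInjectiveOfFinrankEq (B : E →ₗ[ℝ] E →L[ℝ] ℝ) hinj'
    hfin).toContinuousLinearEquiv, ?_⟩
  ext v w
  simp [LinearEquiv.ofInjectiveOfFinrankEq]

variable [FiniteDimensional ℝ E]

theorem IsMetricNear.isInvertible {G : E → E →L[ℝ] E →L[ℝ] ℝ} {y : E} (h : IsMetricNear G y) :
    (G y).IsInvertible :=
  isInvertible_of_pos h.pos.self_of_nhds

theorem IsMetricNear.eq_of_forall {G : E → E →L[ℝ] E →L[ℝ] ℝ} {y : E} (h : IsMetricNear G y)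
    {v w : E} (hvw : ∀ z, G y v z = G y w z) : v = w :=
  h.isInvertible.injective (ContinuousLinearMap.ext hvw)

omit [FiniteDimensional ℝ E] in
theorem IsMetricNear.differentiableAt {G : E → E →L[ℝ] E →L[ℝ] ℝ} {y : E}
    (h : IsMetricNear G y) : DifferentiableAt ℝ G y :=
  h.contDiffAt.differentiableAt (by decide)

omit [FiniteDimensional ℝ E] in
theorem hasFDerivAt_metric_apply {G : E → E →L[ℝ] E →L[ℝ] ℝ} {y : E}
    (hG : DifferentiableAt ℝ G y) (v w : E) :
    HasFDerivAt (fun x => G x v w) (((fderiv ℝ G y).flip v).flip w) y := by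
  refine ((hG.hasFDerivAt.clm_apply (hasFDerivAt_const v y)).clm_apply
    (hasFDerivAt_const w y)).congr_fderiv ?_
  ext; simp

omit [FiniteDimensional ℝ E] in
theorem IsMetricNear.fderiv_symm {G : E → E →L[ℝ] E →L[ℝ] ℝ} {y : E} (h : IsMetricNear G y)
    (u v w : E) : fderiv ℝ G y u v w = fderiv ℝ G y u w v := by
  have h1 := hasFDerivAt_metric_apply h.differentiableAt v w
  have h2 := hasFDerivAt_metric_apply h.differentiableAt w v
  have h3 : (fun z => G z v w) =ᶠ[𝓝 y] fun z => G z w v := by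
    filter_upwards [h.symm] with z hz using hz v w
  have := (h1.congr_of_eventuallyEq h3.symm).unique h2
  simpa using congrArg (fun l => l u) this

/-- The Koszul formula, which characterizes the Christoffel symbols. -/
theorem IsMetricNear.koszul {G : E → E →L[ℝ] E →L[ℝ] ℝ} {y : E} (h : IsMetricNear G y)
    (v w z : E) : G y (christoffel G y v w) z =
      1 / 2 * (fderiv ℝ G y v w z + fderiv ℝ G y w v z - fderiv ℝ G y z v w) := by
  rw [christoffel, h.isInvertible.self_apply_inverse]
  simp

theorem IsMetricNear.christoffel_comm {G : E → E →L[ℝ] E →L[ℝ] ℝ} {y : E}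
    (h : IsMetricNear G y) (v w : E) : christoffel G y v w = christoffel G y w v := by
  refine h.eq_of_forall fun z => ?_
  rw [h.koszul, h.koszul, h.fderiv_symm z v w]
  ring

/-- The Levi-Civita connection is metric. -/
theorem IsMetricNear.fderiv_eq {G : E → E →L[ℝ] E →L[ℝ] ℝ} {y : E} (h : IsMetricNear G y)
    (u v w : E) : fderiv ℝ G y u v w =
      G y (christoffel G y u v) w + G y v (christoffel G y u w) := by
  rw [h.symm.self_of_nhds v, h.koszul, h.koszul, h.fderiv_symm w u v, h.fderiv_symm v u w,
    h.fderiv_symm u w v]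
  ring

theorem IsMetricNear.differentiableAt_christoffelL {G : E → E →L[ℝ] E →L[ℝ] ℝ} {y : E}
    (h : IsMetricNear G y) : DifferentiableAt ℝ (christoffelL G) y := by
  have : CompleteSpace E := FiniteDimensional.complete ℝ E
  have h1 : DifferentiableAt ℝ (fun z => (G z).inverse) y := by
    obtain ⟨e, he⟩ := h.isInvertible
    have hi : DifferentiableAt ℝ (ContinuousLinearMap.inverse :
        (E →L[ℝ] E →L[ℝ] ℝ) → (E →L[ℝ] ℝ) →L[ℝ] E) (G y) := by
      rw [← he]
      exact (contDiffAt_map_inverse (n := 1) e).differentiableAt (by simp)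
    exact hi.comp y h.differentiableAt
  have h2 : DifferentiableAt ℝ (fderiv ℝ G) y :=
    (h.contDiffAt.fderiv_right (m := 1) (by norm_num)).differentiableAt (by simp)
  have h2' : DifferentiableAt ℝ (fun z => (fderiv ℝ G z).flip) y :=
    (flipₗᵢ ℝ E E (E →L[ℝ] ℝ)).toContinuousLinearEquiv.differentiableAt.comp y h2
  have h3 : DifferentiableAt ℝ (fun z => (compL ℝ E (E →L[ℝ] ℝ) E (G z).inverse)) y :=
    (compL ℝ E (E →L[ℝ] ℝ) E).differentiableAt.comp y h1
  have h4 : DifferentiableAt ℝ (fun z => (1 / 2 : ℝ) • (fderiv ℝ G z + (fderiv ℝ G z).flip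
      - ((flipₗᵢ ℝ E E ℝ : (E →L[ℝ] E →L[ℝ] ℝ) →L[ℝ] E →L[ℝ] E →L[ℝ] ℝ) ∘L
        (fderiv ℝ G z).flip))) y :=
    ((h2.fun_add h2').fun_sub ((differentiableAt_const _).clm_comp h2')).fun_const_smul _
  exact h3.clm_comp h4

theorem IsMetricNear.fderiv_christoffel {G : E → E →L[ℝ] E →L[ℝ] ℝ} {y : E}
    (h : IsMetricNear G y) (u v w : E) :
    fderiv ℝ (fun z => christoffel G z v w) y u = fderiv ℝ (christoffelL G) y u v w := by
  have := (h.differentiableAt_christoffelL.hasFDerivAt.clm_apply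
    (hasFDerivAt_const v y)).clm_apply (hasFDerivAt_const w y)
  have h2 : HasFDerivAt (fun z => christoffel G z v w)
      (((fderiv ℝ (christoffelL G) y).flip v).flip w) y := by
    refine this.congr_fderiv ?_
    ext; simp
  rw [h2.fderiv]; simp

/-- The curvature in terms of bilinear maps, whence its linearity in each argument. -/
theorem IsMetricNear.coordCurvature_eq {G : E → E →L[ℝ] E →L[ℝ] ℝ} {y : E}
    (h : IsMetricNear G y) (u v w : E) : coordCurvature G y u v w =
      fderiv ℝ (christoffelL G) y u v w - fderiv ℝ (christoffelL G) y v u w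
        + christoffelL G y u (christoffelL G y v w)
        - christoffelL G y v (christoffelL G y u w) := by
  simp only [coordCurvature, h.fderiv_christoffel, christoffelL_apply]

variable [FiniteDimensional ℝ E']

/-- The vector-valued second fundamental form at `y` of the map `F` from coordinates with the
metric `G` to coordinates with the metric `H`: the difference between the second covariant
derivative of `F` and the image of the Levi-Civita connection of `G`. -/
noncomputable def secondForm (G : E → E →L[ℝ] E →L[ℝ] ℝ) (H : E' → E' →L[ℝ] E' →L[ℝ] ℝ)
    (F : E → E') (y v w : E) : E' :=
  fderiv ℝ (fderiv ℝ F) y v w + christoffel H (F y) (fderiv ℝ F y v) (fderiv ℝ F y w)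
    - fderiv ℝ F y (christoffel G y v w)

omit [FiniteDimensional ℝ E] [FiniteDimensional ℝ E'] in
/-- The derivative of a pullback metric. -/
theorem fderiv_pullback {G : E → E →L[ℝ] E →L[ℝ] ℝ} {H : E' → E' →L[ℝ] E' →L[ℝ] ℝ} {F : E → E'}
    {y : E} (hH : DifferentiableAt ℝ H (F y)) (hF : ContDiffAt ℝ 3 F y)
    (hG : ∀ᶠ z in 𝓝 y, ∀ v w, G z v w = H (F z) (fderiv ℝ F z v) (fderiv ℝ F z w))
    (hG' : DifferentiableAt ℝ G y) (u v w : E) :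
    fderiv ℝ G y u v w = fderiv ℝ H (F y) (fderiv ℝ F y u) (fderiv ℝ F y v) (fderiv ℝ F y w)
      + H (F y) (fderiv ℝ (fderiv ℝ F) y u v) (fderiv ℝ F y w)
      + H (F y) (fderiv ℝ F y v) (fderiv ℝ (fderiv ℝ F) y u w) := by
  have hF1 : HasFDerivAt F (fderiv ℝ F y) y :=
    (hF.differentiableAt (by decide)).hasFDerivAt
  have hF2 : HasFDerivAt (fderiv ℝ F) (fderiv ℝ (fderiv ℝ F) y) y :=
    ((hF.fderiv_right (m := 2) (by norm_num)).differentiableAt (by decide)).hasFDerivAt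
  have h1 := hasFDerivAt_metric_apply hG' v w
  have h2 := ((hH.hasFDerivAt.comp y hF1).clm_apply
    (hF2.clm_apply (hasFDerivAt_const v y))).clm_apply (hF2.clm_apply (hasFDerivAt_const w y))
  have h3 : (fun z => G z v w) =ᶠ[𝓝 y] fun z => H (F z) (fderiv ℝ F z v) (fderiv ℝ F z w) := by
    filter_upwards [hG] with z hz using hz v w
  have := congrArg (fun l => l u) (h1.unique (h2.congr_of_eventuallyEq h3))
  simp at this
  rw [this]
  ring

/-- The second fundamental form of an isometric map is normal. -/
theorem secondForm_orthogonal {G : E → E →L[ℝ] E →L[ℝ] ℝ} {H : E' → E' →L[ℝ] E' →L[ℝ] ℝ}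
    {F : E → E'} {y : E} (hG : IsMetricNear G y) (hH : IsMetricNear H (F y))
    (hF : ContDiffAt ℝ 3 F y)
    (hGH : ∀ᶠ z in 𝓝 y, ∀ v w, G z v w = H (F z) (fderiv ℝ F z v) (fderiv ℝ F z w))
    (v w x : E) : H (F y) (secondForm G H F y v w) (fderiv ℝ F y x) = 0 := by
  have hF2 : ∀ u v, fderiv ℝ (fderiv ℝ F) y u v = fderiv ℝ (fderiv ℝ F) y v u :=
    fun u v => hF.isSymmSndFDerivAt (by simp; norm_num) u v
  have e := fun u v w => fderiv_pullback hH.differentiableAt hF hGH hG.differentiableAt u v w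
  have hk := hG.koszul v w x
  have hk' := hH.koszul (fderiv ℝ F y v) (fderiv ℝ F y w) (fderiv ℝ F y x)
  have hs := hH.symm.self_of_nhds
  rw [e, e, e, hGH.self_of_nhds] at hk
  simp only [secondForm, map_add, map_sub, add_apply, sub_apply]
  rw [hk', hk, hF2 w v, hF2 x v, hF2 x w, hs (fderiv ℝ F y w) (fderiv ℝ (fderiv ℝ F) y v x),
    hs (fderiv ℝ F y v) (fderiv ℝ (fderiv ℝ F) y w x)]
  ring

/-- The Gauss equation. It results from differentiating the orthogonality of the second fundamental
form to the image of `DF`, and antisymmetrizing. -/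
theorem gauss_equation {G : E → E →L[ℝ] E →L[ℝ] ℝ} {H : E' → E' →L[ℝ] E' →L[ℝ] ℝ}
    {F : E → E'} {y : E} (hG : IsMetricNear G y) (hH : IsMetricNear H (F y))
    (hF : ContDiffAt ℝ 3 F y)
    (hGH : ∀ᶠ z in 𝓝 y, ∀ v w, G z v w = H (F z) (fderiv ℝ F z v) (fderiv ℝ F z w))
    (u v w x : E) :
    G y (coordCurvature G y u v w) x =
      H (F y) (coordCurvature H (F y) (fderiv ℝ F y u) (fderiv ℝ F y v) (fderiv ℝ F y w))
        (fderiv ℝ F y x)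
      + H (F y) (secondForm G H F y v w) (secondForm G H F y u x)
      - H (F y) (secondForm G H F y u w) (secondForm G H F y v x) := by
  have hF1 : HasFDerivAt F (fderiv ℝ F y) y :=
    (hF.differentiableAt (by decide)).hasFDerivAt
  have hc2 := hF.fderiv_right (m := 2) (by norm_num)
  have hF2 : HasFDerivAt (fderiv ℝ F) (fderiv ℝ (fderiv ℝ F) y) y :=
    (hc2.differentiableAt (by decide)).hasFDerivAt
  have hF3 : HasFDerivAt (fderiv ℝ (fderiv ℝ F)) (fderiv ℝ (fderiv ℝ (fderiv ℝ F)) y) y :=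
    ((hc2.fderiv_right (m := 1) (by norm_num)).differentiableAt (by decide)).hasFDerivAt
  have hs2 : ∀ u v, fderiv ℝ (fderiv ℝ F) y u v = fderiv ℝ (fderiv ℝ F) y v u :=
    fun u v => hF.isSymmSndFDerivAt (by simp; norm_num) u v
  have hs3 : ∀ u v, fderiv ℝ (fderiv ℝ (fderiv ℝ F)) y u v
      = fderiv ℝ (fderiv ℝ (fderiv ℝ F)) y v u :=
    fun u v => hc2.isSymmSndFDerivAt (by simp) u v
  have hB := hH.differentiableAt_christoffelL.hasFDerivAt.comp y hF1
  have hC := hG.differentiableAt_christoffelL.hasFDerivAt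
  set A := fderiv ℝ F y with hA
  set A2 := fderiv ℝ (fderiv ℝ F) y with hA2
  set A3 := fderiv ℝ (fderiv ℝ (fderiv ℝ F)) y with hA3
  set B := christoffelL H (F y) with hBdef
  set B' := fderiv ℝ (christoffelL H) (F y) with hB'
  set C := christoffelL G y with hCdef
  set C' := fderiv ℝ (christoffelL G) y with hC'
  have hsB : ∀ a b, B a b = B b a := fun a b => hH.christoffel_comm a b
  have hsH := hH.symm.self_of_nhds
  -- The normal field `z ↦ secondForm G H F z v w` and its derivative.
  have hN : ∀ v w, HasFDerivAt (fun z => secondForm G H F z v w) _ y := fun v w =>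
    ((hF3.clm_apply (hasFDerivAt_const v y)).clm_apply (hasFDerivAt_const w y)).add
      ((hB.clm_apply (hF2.clm_apply (hasFDerivAt_const v y))).clm_apply
        (hF2.clm_apply (hasFDerivAt_const w y))) |>.sub
      (hF2.clm_apply ((hC.clm_apply (hasFDerivAt_const v y)).clm_apply (hasFDerivAt_const w y)))
  have hval : ∀ v w, secondForm G H F y v w = A2 v w + B (A v) (A w) - A (C v w) :=
    fun v w => rfl
  have horth := secondForm_orthogonal hG hH hF hGH
  have hder : ∀ u v w x, H (F y) (A3 u v w + B' (A u) (A v) (A w) + B (A2 u v) (A w)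
      + B (A v) (A2 u w) - A2 u (C v w) - A (C' u v w)
      + B (A u) (secondForm G H F y v w)) (A x)
      = - H (F y) (secondForm G H F y v w) (secondForm G H F y u x) := by
    intro u v w x
    have h0 : (fun z => H (F z) (secondForm G H F z v w) (fderiv ℝ F z x)) =ᶠ[𝓝 y]
        fun _ => 0 := by
      filter_upwards [hG.eventually, hF1.continuousAt.eventually hH.eventually,
        hF.eventually (by decide), hGH.eventually_nhds] with z h1 h2 h3 h4
      exact secondForm_orthogonal h1 h2 h3 h4 v w x
    have h1 := (((hH.differentiableAt.hasFDerivAt.comp y hF1).clm_apply (hN v w)).clm_apply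
      (hF2.clm_apply (hasFDerivAt_const x y))).unique
      ((hasFDerivAt_const (0 : ℝ) y).congr_of_eventuallyEq h0)
    have h2 := congrArg (fun l => l u) h1
    have h3 := hH.fderiv_eq (A u) (secondForm G H F y v w) (A x)
    simp only [← christoffelL_apply, ← hBdef] at h3
    have h4 := horth v w (C u x)
    rw [← hA] at h4
    simp [-map_sub, -map_add, ← hA, ← hA2, ← hBdef, ← hCdef] at h2
    have hCvw : christoffel G y v w = C v w := rfl
    rw [h3, hCvw] at h2
    rw [hval u x]
    simp only [map_add, map_sub, add_apply, sub_apply] at h2 h4 ⊢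
    linarith
  have e1 := hder u v w x
  have e2 := hder v u w x
  have hB1 : B (A u) (secondForm G H F y v w)
      = B (A u) (A2 v w) + B (A u) (B (A v) (A w)) - B (A u) (A (C v w)) := by
    rw [hval, map_sub, map_add]
  have hB2 : B (A v) (secondForm G H F y u w)
      = B (A v) (A2 u w) + B (A v) (B (A u) (A w)) - B (A v) (A (C u w)) := by
    rw [hval, map_sub, map_add]
  rw [hB1] at e1
  rw [hB2] at e2
  have hu := horth v w (C u x)
  have hC1 := horth u (C v w) x
  have hC2 := horth v (C u w) x
  rw [hval, ← hA] at hC1 hC2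
  rw [hGH.self_of_nhds, hG.coordCurvature_eq, hH.coordCurvature_eq]
  simp only [← hA, ← hBdef, ← hB', ← hCdef, ← hC', map_add, map_sub, add_apply, sub_apply] at *
  -- The third derivatives of `F` cancel, being symmetric.
  rw [hs3 v u, hs2 v u] at e2
  rw [hsB (A v) (A2 u w)] at e1
  rw [hsB (A u) (A2 v w)] at e2
  rw [hsB (A u) (A2 v w)] at e1
  rw [hsB (A v) (A2 u w)] at e2
  linarith

end CoordinateMetric

/-! ### Warped products in coordinates -/

section WarpedCoordinates

variable {n : ℕ}

theorem warpedMetric_apply {X : Type*} (f : ℝ → ℝ)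
    (g : X → EuclideanSpace ℝ (Fin n) →L[ℝ] EuclideanSpace ℝ (Fin n) →L[ℝ] ℝ) (q : ℝ × X)
    (v w : ℝ × EuclideanSpace ℝ (Fin n)) :
    warpedMetric f g q v w = v.1 * w.1 + f q.1 ^ 2 * g q.2 v.2 w.2 := by
  simp [warpedMetric]

theorem warpedMetric_pos {X : Type*} {f : ℝ → ℝ}
    {g : X → EuclideanSpace ℝ (Fin n) →L[ℝ] EuclideanSpace ℝ (Fin n) →L[ℝ] ℝ} {q : ℝ × X}
    (hf : 0 < f q.1) (hg : ∀ v, v ≠ 0 → 0 < g q.2 v v)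
    (v : ℝ × EuclideanSpace ℝ (Fin n)) (hv : v ≠ 0) : 0 < warpedMetric f g q v v := by
  rw [warpedMetric_apply]
  by_cases h2 : v.2 = 0
  · have h1 : v.1 ≠ 0 := fun h1 => hv (Prod.ext h1 h2)
    simpa only [h2, map_zero, mul_zero, add_zero] using mul_self_pos.2 h1
  · have := hg _ h2
    have h3 := mul_self_nonneg v.1
    positivity

variable {G : EuclideanSpace ℝ (Fin n) →
  EuclideanSpace ℝ (Fin n) →L[ℝ] EuclideanSpace ℝ (Fin n) →L[ℝ] ℝ} {f : ℝ → ℝ}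
  {z : ℝ × EuclideanSpace ℝ (Fin n)}

theorem IsMetricNear.warped (hG : IsMetricNear G z.2) (hf : ContDiffAt ℝ 2 f z.1)
    (hfpos : 0 < f z.1) : IsMetricNear (warpedMetric f G) z where
  contDiffAt := by
    have h1 : ContDiffAt ℝ 2 (fun q : ℝ × EuclideanSpace ℝ (Fin n) => f q.1 ^ 2) z :=
      (ContDiffAt.comp z hf contDiffAt_fst).pow 2
    have h2 : ContDiffAt ℝ 2 (fun q : ℝ × EuclideanSpace ℝ (Fin n) => (G q.2).bilinearComp
        (ContinuousLinearMap.snd ℝ ℝ (EuclideanSpace ℝ (Fin n)))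
        (ContinuousLinearMap.snd ℝ ℝ (EuclideanSpace ℝ (Fin n)))) z := by
      have h3 : ContDiffAt ℝ 2 (fun q : ℝ × EuclideanSpace ℝ (Fin n) => G q.2) z :=
        ContDiffAt.comp z hG.contDiffAt contDiffAt_snd
      have h4 : ContDiffAt ℝ 2 (fun q : ℝ × EuclideanSpace ℝ (Fin n) =>
          (((ContinuousLinearMap.compL ℝ (ℝ × EuclideanSpace ℝ (Fin n)) (EuclideanSpace ℝ (Fin n))
          ℝ).flip (ContinuousLinearMap.snd ℝ ℝ (EuclideanSpace ℝ (Fin n)))) ∘L (G q.2)) ∘L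
            (ContinuousLinearMap.snd ℝ ℝ (EuclideanSpace ℝ (Fin n)))) z :=
        (contDiffAt_const.clm_comp h3).clm_comp contDiffAt_const
      exact h4.congr_of_eventuallyEq (Eventually.of_forall fun q =>
        ContinuousLinearMap.ext fun _ => ContinuousLinearMap.ext fun _ => rfl)
    exact contDiffAt_const.add (h1.smul h2)
  symm := by
    filter_upwards [continuous_snd.continuousAt.eventually hG.symm] with q hq v w
    rw [warpedMetric_apply, warpedMetric_apply, hq, mul_comm v.1]
  pos := by
    filter_upwards [continuous_snd.continuousAt.eventually hG.pos,
      continuous_fst.continuousAt.eventually (hf.continuousAt.eventually (lt_mem_nhds hfpos))]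
      with q hq hq' v hv using warpedMetric_pos hq' hq v hv

theorem fderiv_warpedMetric (hG : IsMetricNear G z.2) (hf : ContDiffAt ℝ 2 f z.1)
    (hfpos : 0 < f z.1) (u v w : ℝ × EuclideanSpace ℝ (Fin n)) :
    fderiv ℝ (warpedMetric f G) z u v w = 2 * f z.1 * deriv f z.1 * u.1 * G z.2 v.2 w.2
      + f z.1 ^ 2 * fderiv ℝ G z.2 u.2 v.2 w.2 := by
  have h1 := hasFDerivAt_metric_apply (hG.warped hf hfpos).differentiableAt v w
  have h2 : HasFDerivAt (fun q : ℝ × EuclideanSpace ℝ (Fin n) => f q.1) _ z :=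
    (hf.differentiableAt (by decide)).hasDerivAt.hasFDerivAt.comp z hasFDerivAt_fst
  have h3 : HasFDerivAt (fun q : ℝ × EuclideanSpace ℝ (Fin n) => G q.2 v.2 w.2) _ z :=
    (hasFDerivAt_metric_apply hG.differentiableAt v.2 w.2).comp z hasFDerivAt_snd
  have h4 := ((h2.pow 2).mul h3).const_add (v.1 * w.1)
  have h5 := congrArg (fun l => l u) (h1.unique (h4.congr_of_eventuallyEq
    (Eventually.of_forall fun q => warpedMetric_apply f G q v w)))
  simp at h5
  rw [h5]
  ring

theorem christoffel_warpedMetric (hG : IsMetricNear G z.2) (hf : ContDiffAt ℝ 2 f z.1)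
    (hfpos : 0 < f z.1) (u v : ℝ × EuclideanSpace ℝ (Fin n)) :
    christoffel (warpedMetric f G) z u v = (-(f z.1 * deriv f z.1 * G z.2 u.2 v.2),
      christoffel G z.2 u.2 v.2 + (deriv f z.1 / f z.1) • (u.1 • v.2 + v.1 • u.2)) := by
  refine (hG.warped hf hfpos).eq_of_forall fun w => ?_
  rw [(hG.warped hf hfpos).koszul]
  simp only [fderiv_warpedMetric hG hf hfpos, warpedMetric_apply, map_add, map_smul, add_apply,
    smul_apply, hG.koszul, smul_eq_mul]
  rw [hG.symm.self_of_nhds v.2 w.2, hG.symm.self_of_nhds u.2 w.2, hG.symm.self_of_nhds w.2 v.2,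
    hG.symm.self_of_nhds w.2 u.2]
  field_simp
  ring

theorem fderiv_christoffel_warpedMetric (hG : IsMetricNear G z.2) (hf : ContDiffAt ℝ 2 f z.1)
    (hfpos : 0 < f z.1) (u v w : ℝ × EuclideanSpace ℝ (Fin n)) :
    fderiv ℝ (fun q => christoffel (warpedMetric f G) q v w) z u =
      (-((deriv f z.1 ^ 2 + f z.1 * deriv (deriv f) z.1) * u.1 * G z.2 v.2 w.2
          + f z.1 * deriv f z.1 * fderiv ℝ G z.2 u.2 v.2 w.2),
        fderiv ℝ (fun x => christoffel G x v.2 w.2) z.2 u.2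
          + (u.1 * (deriv (deriv f) z.1 / f z.1 - deriv f z.1 ^ 2 / f z.1 ^ 2)) •
            (v.1 • w.2 + w.1 • v.2)) := by
  have hd : HasDerivAt f (deriv f z.1) z.1 := (hf.differentiableAt (by decide)).hasDerivAt
  have hd2 : HasDerivAt (deriv f) (deriv (deriv f) z.1) z.1 := by
    refine DifferentiableAt.hasDerivAt ?_
    have := (hf.fderiv_right (m := 1) (by norm_num)).differentiableAt (by decide)
    exact this.clm_apply (differentiableAt_const (1 : ℝ))
  have h1 : HasFDerivAt (fun q : ℝ × EuclideanSpace ℝ (Fin n) => f q.1 * deriv f q.1) _ z :=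
    HasFDerivAt.comp z (hd.mul hd2).hasFDerivAt hasFDerivAt_fst
  have h2 : HasFDerivAt (fun q : ℝ × EuclideanSpace ℝ (Fin n) => deriv f q.1 / f q.1) _ z :=
    HasFDerivAt.comp z (hd2.div hd hfpos.ne').hasFDerivAt hasFDerivAt_fst
  have h3 : HasFDerivAt (fun q : ℝ × EuclideanSpace ℝ (Fin n) => G q.2 v.2 w.2) _ z :=
    (hasFDerivAt_metric_apply hG.differentiableAt v.2 w.2).comp z hasFDerivAt_snd
  have h4 : HasFDerivAt (fun q : ℝ × EuclideanSpace ℝ (Fin n) => christoffel G q.2 v.2 w.2) _ z :=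
    HasFDerivAt.comp z (DifferentiableAt.hasFDerivAt (((hG.differentiableAt_christoffelL.clm_apply
      (differentiableAt_const v.2)).clm_apply (differentiableAt_const w.2)) :
      DifferentiableAt ℝ (fun x => christoffel G x v.2 w.2) z.2)) hasFDerivAt_snd
  have h5 := (h1.mul h3).neg.prodMk (h4.add (h2.smul_const (v.1 • w.2 + w.1 • v.2)))
  have h6 : (fun q => christoffel (warpedMetric f G) q v w) =ᶠ[𝓝 z] fun q =>
      (-(f q.1 * deriv f q.1 * G q.2 v.2 w.2),
        christoffel G q.2 v.2 w.2 + (deriv f q.1 / f q.1) • (v.1 • w.2 + w.1 • v.2)) := by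
    filter_upwards [continuous_snd.continuousAt.eventually hG.eventually,
      continuous_fst.continuousAt.eventually (hf.eventually (by decide)),
      continuous_fst.continuousAt.eventually (hf.continuousAt.eventually (lt_mem_nhds hfpos))]
      with q h1 h2 h3 using christoffel_warpedMetric h1 h2 h3 v w
  rw [(h5.congr_of_eventuallyEq h6).fderiv]
  ext : 1
  · simp
    ring
  · have e : (deriv (deriv f) z.1 * f z.1 - deriv f z.1 * deriv f z.1) / f z.1 ^ 2
        = deriv (deriv f) z.1 / f z.1 - deriv f z.1 ^ 2 / f z.1 ^ 2 := by field_simp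
    simp [christoffelL_apply, e]

theorem coordCurvature_eq_zero_of_not_linearIndependent {E : Type*} [NormedAddCommGroup E]
    [NormedSpace ℝ E] [FiniteDimensional ℝ E] {G : E → E →L[ℝ] E →L[ℝ] ℝ} {y : E}
    (hG : IsMetricNear G y) {u v : E} (h : ¬ LinearIndependent ℝ ![u, v]) (w : E) :
    coordCurvature G y u v w = 0 := by
  have key : ∀ r : ℝ, ∀ x, coordCurvature G y x (r • x) w = 0 := by
    intro r x
    simp only [hG.coordCurvature_eq, map_smul, smul_apply]
    abel
  by_cases hu : u = 0
  · subst hu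
    simp only [hG.coordCurvature_eq, map_zero, zero_apply]
    abel
  · rw [LinearIndependent.pair_iff' hu] at h
    push Not at h
    obtain ⟨r, rfl⟩ := h
    exact key r u

/-- The curvature of a warped product over a space of constant curvature `c`: planes tangent to the
slices have curvature `(c - f'²) / f²`, planes containing `∂_t` have curvature `-f'' / f`. -/
theorem curvature_warpedMetric {c : ℝ} (hG : IsMetricNear G z.2) (hf : ContDiffAt ℝ 2 f z.1)
    (hfpos : 0 < f z.1)
    (hc : ∀ u v, G z.2 (coordCurvature G z.2 u v v) u
      = c * (G z.2 u u * G z.2 v v - G z.2 u v ^ 2))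
    (U V : ℝ × EuclideanSpace ℝ (Fin n)) :
    warpedMetric f G z (coordCurvature (warpedMetric f G) z U V V) U =
      (c - deriv f z.1 ^ 2) / f z.1 ^ 2 * (warpedMetric f G z U U * warpedMetric f G z V V
        - warpedMetric f G z U V ^ 2)
      + (- deriv (deriv f) z.1 / f z.1 - (c - deriv f z.1 ^ 2) / f z.1 ^ 2) *
        (U.1 ^ 2 * warpedMetric f G z V V - 2 * U.1 * V.1 * warpedMetric f G z U V
          + V.1 ^ 2 * warpedMetric f G z U U) := by
  obtain ⟨a, u⟩ := U
  obtain ⟨b, v⟩ := V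
  have h1 := hG.fderiv_eq u v v
  have h2 := hG.fderiv_eq v u v
  have hs := hG.symm.self_of_nhds
  have hc := hc u v
  rw [coordCurvature] at hc ⊢
  simp only [fderiv_christoffel_warpedMetric hG hf hfpos, christoffel_warpedMetric hG hf hfpos]
  have hl1 : ∀ x y y', christoffel G z.2 x (y + y')
      = christoffel G z.2 x y + christoffel G z.2 x y' :=
    fun x y y' => map_add (christoffelL G z.2 x) y y'
  have hl2 : ∀ x (r : ℝ) y, christoffel G z.2 x (r • y) = r • christoffel G z.2 x y :=
    fun x r y => map_smul (christoffelL G z.2 x) r y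
  have hcomm := hG.christoffel_comm v u
  simp only [hl1, hl2, h1, h2, hcomm, warpedMetric_apply, map_add, map_smul, map_sub, add_apply,
    smul_apply, sub_apply, smul_eq_mul, hs v u,
    hs v (christoffel G z.2 u v), hs (christoffel G z.2 v v) u, hs (christoffel G z.2 u v) u]
    at hc ⊢
  have h3 : (f z.1) ≠ 0 := hfpos.ne'
  have hc' : G z.2 (fderiv ℝ (fun z => christoffel G z v v) z.2 u) u =
      c * (G z.2 u u * G z.2 v v - G z.2 u v ^ 2)
        + G z.2 (fderiv ℝ (fun z => christoffel G z u v) z.2 v) u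
        - G z.2 (christoffel G z.2 u (christoffel G z.2 v v)) u
        + G z.2 (christoffel G z.2 v (christoffel G z.2 u v)) u := by linarith
  rw [hc']
  field_simp
  ring

end WarpedCoordinates

end

/-! ### Riemannian metrics on manifolds -/

section MetricOfBundle

set_option maxSynthPendingDepth 3

variable {n : ℕ} {X : Type*} [TopologicalSpace X] [ChartedSpace (EuclideanSpace ℝ (Fin n)) X]

/-- Riemannian metrics on a manifold, as fields of bilinear forms which are smooth in charts. -/
structure IsRiemannianMetric
    (g : X → EuclideanSpace ℝ (Fin n) →L[ℝ] EuclideanSpace ℝ (Fin n) →L[ℝ] ℝ) : Prop where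
  symm : ∀ x v w, g x v w = g x w v
  pos : ∀ x v, v ≠ 0 → 0 < g x v v
  contDiffOn : ∀ x, ContDiffOn ℝ ∞ (chartMetric (𝓡 n) g x) (extChartAt (𝓡 n) x).target

theorem contMDiffOn_chartFrame [IsManifold (𝓡 n) ∞ X] (x : X) (v : EuclideanSpace ℝ (Fin n)) :
    ContMDiffOn 𝓘(ℝ, EuclideanSpace ℝ (Fin n)) (𝓡 n).tangent ∞
      (fun y => (⟨(extChartAt (𝓡 n) x).symm y, chartFrame (𝓡 n) x y v⟩ : TangentBundle (𝓡 n) X))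
      (extChartAt (𝓡 n) x).target := by
  have ho := isOpen_extChartAt_target (I := 𝓡 n) x
  have h1 := (contMDiffOn_extChartAt_symm (I := 𝓡 n) (n := ∞) x).contMDiffOn_tangentMapWithin
    (m := ∞) (by simp) ho.uniqueMDiffOn
  have h2 : ContMDiffOn 𝓘(ℝ, EuclideanSpace ℝ (Fin n)) 𝓘(ℝ, EuclideanSpace ℝ (Fin n)).tangent ∞
      (fun y => (⟨y, v⟩ : TangentBundle 𝓘(ℝ, EuclideanSpace ℝ (Fin n))
        (EuclideanSpace ℝ (Fin n)))) (extChartAt (𝓡 n) x).target :=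
    contMDiffOn_vectorSpace_iff_contDiffOn.2 contDiffOn_const
  refine (h1.comp h2 fun y hy => hy).congr fun y hy => ?_
  simp only [Function.comp_def, tangentMapWithin, chartFrame]
  rw [mfderivWithin_of_isOpen ho hy]
  rfl

/-- The smoothness of the metric of a Riemannian bundle, read in the tangent frames of charts. -/
theorem isRiemannianMetric_riemannianMetricOf [IsManifold (𝓡 n) ∞ X]
    [Bundle.RiemannianBundle (fun x : X => TangentSpace (𝓡 n) x)]
    [IsContMDiffRiemannianBundle (𝓡 n) ∞ (EuclideanSpace ℝ (Fin n))
      (fun x : X => TangentSpace (𝓡 n) x)] : IsRiemannianMetric (riemannianMetricOf n X) where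
  symm x v w :=
    (Bundle.RiemannianBundle.g (E := fun x : X => TangentSpace (𝓡 n) x)).symm x v w
  pos x v hv :=
    (Bundle.RiemannianBundle.g (E := fun x : X => TangentSpace (𝓡 n) x)).pos x v hv
  contDiffOn x := by
    refine contDiffOn_clm_apply.2 fun v => contDiffOn_clm_apply.2 fun w => ?_
    exact (ContMDiffOn.inner_bundle (contMDiffOn_chartFrame x v)
      (contMDiffOn_chartFrame x w)).contDiffOn

end MetricOfBundle

section

set_option maxSynthPendingDepth 3

attribute [-instance]
  Bundle.instNormedAddCommGroupOfRiemannianBundleOfIsTopologicalAddGroupOfContinuousConstSMulReal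
  Bundle.instInnerProductSpaceReal

open Filter Topology ContinuousLinearMap

section ChartMetric

section General

variable {E : Type*} [NormedAddCommGroup E] [NormedSpace ℝ E]

theorem christoffel_congr {G G' : E → E →L[ℝ] E →L[ℝ] ℝ} {y : E} (h : G =ᶠ[𝓝 y] G') :
    christoffel G =ᶠ[𝓝 y] christoffel G' := by
  filter_upwards [h.eventuallyEq_nhds] with z hz
  funext v w
  simp only [christoffel, hz.fderiv_eq, hz.self_of_nhds]

theorem coordCurvature_congr {G G' : E → E →L[ℝ] E →L[ℝ] ℝ} {y : E} (h : G =ᶠ[𝓝 y] G') :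
    coordCurvature G y = coordCurvature G' y := by
  have h1 := christoffel_congr h
  have h2 : ∀ v w, (fun z => christoffel G z v w) =ᶠ[𝓝 y] fun z => christoffel G' z v w :=
    fun v w => by filter_upwards [h1] with z hz using by rw [hz]
  funext u v w
  simp only [coordCurvature, (h2 _ _).fderiv_eq, h1.self_of_nhds]

variable {H : Type*} [TopologicalSpace H] (I : ModelWithCorners ℝ E H) [I.Boundaryless]
  {X : Type*} [TopologicalSpace X] [ChartedSpace H X] [IsManifold I 1 X]

theorem chartFrame_self (p : X) :
    chartFrame I p (extChartAt I p p) = ContinuousLinearMap.id ℝ E := by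
  have h := mfderivWithin_range_extChartAt_symm (I := I) (x := p)
  rw [I.range_eq_univ, mfderivWithin_univ] at h
  exact h

theorem chartMetric_self (g : X → E →L[ℝ] E →L[ℝ] ℝ) (p : X) :
    chartMetric I g p (extChartAt I p p) = g p := by
  ext v w
  simp only [chartMetric, chartFrame_self, bilinearComp_apply, id_apply]
  rw [extChartAt_to_inv]

theorem injective_chartFrame (p : X) {y : E} (hy : y ∈ (extChartAt I p).target) :
    Function.Injective (chartFrame I p y) := by
  have h := (isInvertible_mfderivWithin_extChartAt_symm (I := I) hy).injective
  rw [I.range_eq_univ, mfderivWithin_univ] at h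
  exact h

end General

variable {n : ℕ} {X : Type*} [TopologicalSpace X] [ChartedSpace (EuclideanSpace ℝ (Fin n)) X]
  [IsManifold (𝓡 n) ∞ X] {f : ℝ → ℝ}
  {g : X → EuclideanSpace ℝ (Fin n) →L[ℝ] EuclideanSpace ℝ (Fin n) →L[ℝ] ℝ}

theorem IsRiemannianMetric.isMetricNear (hg : IsRiemannianMetric g) (p : X) :
    IsMetricNear (chartMetric (𝓡 n) g p) (extChartAt (𝓡 n) p p) where
  contDiffAt := ((hg.contDiffOn p).contDiffAt (extChartAt_target_mem_nhds p)).of_le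
    (WithTop.coe_le_coe.2 le_top)
  symm := Eventually.of_forall fun z v w => hg.symm _ _ _
  pos := by
    filter_upwards [extChartAt_target_mem_nhds (I := 𝓡 n) p] with z hz v hv
    refine hg.pos _ _ fun h => hv ?_
    exact injective_chartFrame (𝓡 n) p hz (h.trans (map_zero _).symm)

omit [IsManifold (𝓡 n) ∞ X] in
theorem extChartAt_real_prod_symm (q : ℝ × X) (z : ℝ × EuclideanSpace ℝ (Fin n)) :
    (extChartAt (𝓘(ℝ, ℝ).prod (𝓡 n)) q).symm z = (z.1, (extChartAt (𝓡 n) q.2).symm z.2) := by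
  rw [extChartAt_prod]
  rfl

omit [IsManifold (𝓡 n) ∞ X] in
theorem extChartAt_real_prod (q q' : ℝ × X) :
    extChartAt (𝓘(ℝ, ℝ).prod (𝓡 n)) q q' = (q'.1, extChartAt (𝓡 n) q.2 q'.2) := by
  rw [extChartAt_prod]
  rfl

theorem chartFrame_real_prod (q : ℝ × X) {z : ℝ × EuclideanSpace ℝ (Fin n)}
    (hz : z.2 ∈ (extChartAt (𝓡 n) q.2).target) (v : ℝ × EuclideanSpace ℝ (Fin n)) :
    chartFrame (𝓘(ℝ, ℝ).prod (𝓡 n)) q z v = (v.1, chartFrame (𝓡 n) q.2 z.2 v.2) := by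
  have h1 : MDifferentiableAt 𝓘(ℝ, EuclideanSpace ℝ (Fin n)) (𝓡 n)
      (extChartAt (𝓡 n) q.2).symm z.2 := by
    have := mdifferentiableWithinAt_extChartAt_symm (I := 𝓡 n) hz
    rwa [(𝓡 n).range_eq_univ, mdifferentiableWithinAt_univ] at this
  have h2 : HasMFDerivAt 𝓘(ℝ, ℝ × EuclideanSpace ℝ (Fin n)) 𝓘(ℝ, EuclideanSpace ℝ (Fin n))
      (Prod.snd : ℝ × EuclideanSpace ℝ (Fin n) → EuclideanSpace ℝ (Fin n)) z
      (ContinuousLinearMap.snd ℝ ℝ (EuclideanSpace ℝ (Fin n))) := hasFDerivAt_snd.hasMFDerivAt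
  have h3 : HasMFDerivAt 𝓘(ℝ, ℝ × EuclideanSpace ℝ (Fin n)) 𝓘(ℝ, ℝ)
      (Prod.fst : ℝ × EuclideanSpace ℝ (Fin n) → ℝ) z
      (ContinuousLinearMap.fst ℝ ℝ (EuclideanSpace ℝ (Fin n))) := hasFDerivAt_fst.hasMFDerivAt
  have h4 := h3.prodMk (HasMFDerivAt.comp z h1.hasMFDerivAt h2)
  have h5 : ((extChartAt (𝓘(ℝ, ℝ).prod (𝓡 n)) q).symm : ℝ × EuclideanSpace ℝ (Fin n) → ℝ × X)
      = fun z => (z.1, ((extChartAt (𝓡 n) q.2).symm ∘ Prod.snd) z) :=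
    funext fun z => extChartAt_real_prod_symm q z
  rw [chartFrame, h5, h4.mfderiv]
  rfl

/-- In a product chart, the warped product metric is the warped product of a chart metric. -/
theorem chartMetric_warpedMetric (q : ℝ × X) :
    chartMetric (𝓘(ℝ, ℝ).prod (𝓡 n)) (warpedMetric f g) q
      =ᶠ[𝓝 (extChartAt (𝓘(ℝ, ℝ).prod (𝓡 n)) q q)]
      warpedMetric f (chartMetric (𝓡 n) g q.2) := by
  rw [extChartAt_real_prod]
  filter_upwards [continuous_snd.continuousAt.eventually
    (extChartAt_target_mem_nhds (I := 𝓡 n) q.2)] with z hz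
  refine ContinuousLinearMap.ext fun v => ContinuousLinearMap.ext fun w => ?_
  simp only [chartMetric, bilinearComp_apply, chartFrame_real_prod q hz,
    extChartAt_real_prod_symm, warpedMetric_apply]

theorem IsRiemannianMetric.isMetricNear_warped (hg : IsRiemannianMetric g) (q : ℝ × X)
    (hf : ContDiffAt ℝ 2 f q.1) (hfpos : 0 < f q.1) :
    IsMetricNear (warpedMetric f (chartMetric (𝓡 n) g q.2)) (q.1, extChartAt (𝓡 n) q.2 q.2) :=
  IsMetricNear.warped (z := (q.1, extChartAt (𝓡 n) q.2 q.2)) (hg.isMetricNear q.2) hf hfpos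

/-- The strict Cauchy-Schwarz inequality: the denominator of a sectional curvature is positive. -/
theorem gram_pos {E : Type*} [NormedAddCommGroup E] [NormedSpace ℝ E] {B : E →L[ℝ] E →L[ℝ] ℝ}
    (hs : ∀ v w, B v w = B w v) (hB : ∀ v, v ≠ 0 → 0 < B v v) {u v : E}
    (h : LinearIndependent ℝ ![u, v]) : 0 < B u u * B v v - B u v ^ 2 := by
  have hv : 0 < B v v := hB v (h.ne_zero 1)
  have hw : B v v • u - B u v • v ≠ 0 := by
    intro h0
    have := LinearIndependent.pair_iff.1 h (B v v) (-B u v) (by rw [neg_smul, ← sub_eq_add_neg, h0])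
    exact hv.ne' this.1
  have := hB _ hw
  simp only [map_sub, map_smul, sub_apply, smul_apply, smul_eq_mul, hs v u] at this
  have h2 : 0 < B v v * (B u u * B v v - B u v ^ 2) := by linarith
  exact (mul_pos_iff_of_pos_left hv).1 h2

/-- Constant sectional curvature, without the restriction to independent vectors. -/
theorem IsRiemannianMetric.curvature_eq (hg : IsRiemannianMetric g) {c : ℝ} {W : Set X}
    (hc : HasConstantCurvatureOn (𝓡 n) g c W) {p : X} (hp : p ∈ W)
    (u v : EuclideanSpace ℝ (Fin n)) : g p (curvatureAt (𝓡 n) g p u v v) u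
      = c * (g p u u * g p v v - g p u v ^ 2) := by
  by_cases h : LinearIndependent ℝ ![u, v]
  · rw [← hc p hp u v h, sectionalCurvature,
      div_mul_cancel₀ _ (gram_pos (hg.symm p) (hg.pos p) h).ne']
  · have h0 : g p u u * g p v v - g p u v ^ 2 = 0 := by
      have hs := hg.symm p
      by_cases hu : u = 0
      · simp [hu]
      · rw [LinearIndependent.pair_iff' hu] at h
        push Not at h
        obtain ⟨r, rfl⟩ := h
        simp only [map_smul, smul_apply, smul_eq_mul]
        ring
    rw [curvatureAt, coordCurvature_eq_zero_of_not_linearIndependent (hg.isMetricNear p) h, h0]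
    simp

/-- The curvature of a warped product over a manifold of constant curvature. -/
theorem IsRiemannianMetric.curvature_warped (hg : IsRiemannianMetric g) {c : ℝ}
    (hc : HasConstantCurvatureOn (𝓡 n) g c Set.univ) (q : ℝ × X)
    (hf : ContDiffAt ℝ 2 f q.1) (hfpos : 0 < f q.1) (U V : ℝ × EuclideanSpace ℝ (Fin n)) :
    warpedMetric f g q (curvatureAt (𝓘(ℝ, ℝ).prod (𝓡 n)) (warpedMetric f g) q U V V) U =
      (c - deriv f q.1 ^ 2) / f q.1 ^ 2 * (warpedMetric f g q U U * warpedMetric f g q V V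
        - warpedMetric f g q U V ^ 2)
      + (- deriv (deriv f) q.1 / f q.1 - (c - deriv f q.1 ^ 2) / f q.1 ^ 2) *
        (U.1 ^ 2 * warpedMetric f g q V V - 2 * U.1 * V.1 * warpedMetric f g q U V
          + V.1 ^ 2 * warpedMetric f g q U U) := by
  have hself : ∀ v w, chartMetric (𝓡 n) g q.2 (extChartAt (𝓡 n) q.2 q.2) v w = g q.2 v w :=
    fun v w => by rw [chartMetric_self]
  have h := curvature_warpedMetric (z := (q.1, extChartAt (𝓡 n) q.2 q.2)) (c := c)
    (hg.isMetricNear q.2) hf hfpos (fun u v => by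
      simpa only [hself, curvatureAt] using hg.curvature_eq hc (Set.mem_univ q.2) u v) U V
  rw [curvatureAt, coordCurvature_congr (chartMetric_warpedMetric q), extChartAt_real_prod]
  simp only [warpedMetric_apply, hself] at h ⊢
  exact h

/-- If the radial and the tangential sectional curvatures of a warped product over a space form
agree over an open interval, then the curvature is constant there: Schur's lemma in this special
case. -/
theorem IsRiemannianMetric.exists_hasConstantCurvatureOn_warped (hg : IsRiemannianMetric g) {c : ℝ}
    (hc : HasConstantCurvatureOn (𝓡 n) g c Set.univ) {J : Set ℝ} (hJ : IsOpen J)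
    (hJ' : J.OrdConnected) (hf : ContDiffOn ℝ 2 f J) (hfpos : ∀ t ∈ J, 0 < f t)
    (h0 : ∀ t ∈ J, - deriv (deriv f) t / f t = (c - deriv f t ^ 2) / f t ^ 2) :
    ∃ κ : ℝ, HasConstantCurvatureOn (𝓘(ℝ, ℝ).prod (𝓡 n)) (warpedMetric f g) κ
      (J ×ˢ Set.univ) := by
  have hfat : ∀ t ∈ J, ContDiffAt ℝ 2 f t := fun t ht => hf.contDiffAt (hJ.mem_nhds ht)
  have hder : ∀ t ∈ J, HasDerivAt (fun t => (c - deriv f t ^ 2) / f t ^ 2) 0 t := by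
    intro t ht
    have hd : HasDerivAt f (deriv f t) t := ((hfat t ht).differentiableAt (by decide)).hasDerivAt
    have hd2 : HasDerivAt (deriv f) (deriv (deriv f) t) t := by
      refine DifferentiableAt.hasDerivAt ?_
      have := ((hfat t ht).fderiv_right (m := 1) (by norm_num)).differentiableAt (by decide)
      exact this.clm_apply (differentiableAt_const (1 : ℝ))
    have hne := (hfpos t ht).ne'
    have h1 := ((hd2.pow 2).const_sub c).div (hd.pow 2) (pow_ne_zero 2 hne)
    refine h1.congr_deriv ?_
    have h2 := h0 t ht
    rw [div_eq_div_iff hne (pow_ne_zero 2 hne)] at h2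
    have h3 : c - deriv f t ^ 2 = - deriv (deriv f) t * f t := by
      apply mul_right_cancel₀ hne
      rw [← h2]; ring
    rw [div_eq_zero_iff]
    left
    simp only [Pi.pow_apply, h3]
    norm_num
    ring
  obtain ⟨κ, hκ⟩ : ∃ κ, ∀ t ∈ J, (c - deriv f t ^ 2) / f t ^ 2 = κ :=
    hJ.exists_is_const_of_deriv_eq_zero hJ'.isPreconnected
      (fun t ht => (hder t ht).differentiableAt.differentiableWithinAt)
      (fun t ht => (hder t ht).deriv)
  refine ⟨κ, fun q hq U V hUV => ?_⟩
  have hpos := gram_pos (B := warpedMetric f g q)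
    (fun v w => by rw [warpedMetric_apply, warpedMetric_apply, hg.symm, mul_comm v.1])
    (warpedMetric_pos (hfpos _ hq.1) (hg.pos q.2)) hUV
  rw [sectionalCurvature, hg.curvature_warped hc q (hfat _ hq.1) (hfpos _ hq.1),
    h0 _ hq.1, hκ _ hq.1, sub_self, zero_mul, add_zero, mul_div_cancel_right₀ _ hpos.ne']

end ChartMetric

/-! ### Totally umbilical hypersurfaces -/

section Immersion

theorem IsMetricNear.congr {E : Type*} [NormedAddCommGroup E] [NormedSpace ℝ E]
    {G G' : E → E →L[ℝ] E →L[ℝ] ℝ} {y : E} (h : IsMetricNear G y) (hG : G' =ᶠ[𝓝 y] G) :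
    IsMetricNear G' y where
  contDiffAt := h.contDiffAt.congr_of_eventuallyEq hG
  symm := by filter_upwards [h.symm, hG] with z hz h1 using by rwa [h1]
  pos := by filter_upwards [h.pos, hG] with z hz h1 using by rwa [h1]

variable {n : ℕ} {X : Type*} [TopologicalSpace X] [ChartedSpace (EuclideanSpace ℝ (Fin n)) X]
  [IsManifold (𝓡 n) ∞ X] {M : Type*} [TopologicalSpace M]
  [ChartedSpace (EuclideanSpace ℝ (Fin n)) M] [IsManifold (𝓡 n) ∞ M]
  {f : ℝ → ℝ} {J : Set ℝ} {χ : M → ℝ × X}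
  {g : M → EuclideanSpace ℝ (Fin n) →L[ℝ] EuclideanSpace ℝ (Fin n) →L[ℝ] ℝ}
  {gX : X → EuclideanSpace ℝ (Fin n) →L[ℝ] EuclideanSpace ℝ (Fin n) →L[ℝ] ℝ}
  {h : ℝ × X → (ℝ × EuclideanSpace ℝ (Fin n)) →L[ℝ] (ℝ × EuclideanSpace ℝ (Fin n)) →L[ℝ] ℝ}

omit [IsManifold (𝓡 n) ∞ X] [IsManifold (𝓡 n) ∞ M] in
theorem contDiffAt_writtenInExtChartAt
    (hχ : ContMDiff (𝓡 n) (𝓘(ℝ, ℝ).prod (𝓡 n)) ∞ χ) (p : M) :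
    ContDiffAt ℝ ∞ (writtenInExtChartAt (𝓡 n) (𝓘(ℝ, ℝ).prod (𝓡 n)) p χ)
      (extChartAt (𝓡 n) p p) := by
  have h1 := (contMDiffAt_iff.1 (hχ p)).2
  rw [(𝓡 n).range_eq_univ] at h1
  exact h1.contDiffAt univ_mem

omit [IsManifold (𝓡 n) ∞ X] [IsManifold (𝓡 n) ∞ M] in
theorem fderiv_writtenInExtChartAt
    (hχ : ContMDiff (𝓡 n) (𝓘(ℝ, ℝ).prod (𝓡 n)) ∞ χ) (p : M) :
    fderiv ℝ (writtenInExtChartAt (𝓡 n) (𝓘(ℝ, ℝ).prod (𝓡 n)) p χ) (extChartAt (𝓡 n) p p)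
      = differential χ p := by
  have h1 := (hχ p).mdifferentiableAt (by simp)
  rw [differential, h1.mfderiv, (𝓡 n).range_eq_univ, fderivWithin_univ]

/-- The differential of an immersion at the points near `p`, in the charts at `p` and `χ p`. -/
theorem chartFrame_fderiv_writtenInExtChartAt
    (hχ : ContMDiff (𝓡 n) (𝓘(ℝ, ℝ).prod (𝓡 n)) ∞ χ) (p : M) :
    ∀ᶠ z in 𝓝 (extChartAt (𝓡 n) p p),
      (extChartAt (𝓘(ℝ, ℝ).prod (𝓡 n)) (χ p)).symm
        (writtenInExtChartAt (𝓡 n) (𝓘(ℝ, ℝ).prod (𝓡 n)) p χ z)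
        = χ ((extChartAt (𝓡 n) p).symm z) ∧
      ∀ v, chartFrame (𝓘(ℝ, ℝ).prod (𝓡 n)) (χ p)
          (writtenInExtChartAt (𝓡 n) (𝓘(ℝ, ℝ).prod (𝓡 n)) p χ z)
          (fderiv ℝ (writtenInExtChartAt (𝓡 n) (𝓘(ℝ, ℝ).prod (𝓡 n)) p χ) z v)
        = differential χ ((extChartAt (𝓡 n) p).symm z) (chartFrame (𝓡 n) p z v) := by
  set F := writtenInExtChartAt (𝓡 n) (𝓘(ℝ, ℝ).prod (𝓡 n)) p χ with hF
  have hF1 : ∀ᶠ z in 𝓝 (extChartAt (𝓡 n) p p), ContDiffAt ℝ 1 F z :=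
    ((contDiffAt_writtenInExtChartAt hχ p).of_le
      (WithTop.coe_le_coe.2 le_top)).eventually (by simp)
  have hsrc : ∀ᶠ z in 𝓝 (extChartAt (𝓡 n) p p), χ ((extChartAt (𝓡 n) p).symm z) ∈
      (extChartAt (𝓘(ℝ, ℝ).prod (𝓡 n)) (χ p)).source := by
    have hc : ContinuousAt (χ ∘ (extChartAt (𝓡 n) p).symm) (extChartAt (𝓡 n) p p) :=
      hχ.continuous.continuousAt.comp (continuousAt_extChartAt_symm p)
    refine hc.eventually ?_
    rw [Function.comp_apply, extChartAt_to_inv]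
    exact extChartAt_source_mem_nhds (χ p)
  have hinv : (extChartAt (𝓘(ℝ, ℝ).prod (𝓡 n)) (χ p)).symm ∘ F =ᶠ[𝓝 (extChartAt (𝓡 n) p p)]
      χ ∘ (extChartAt (𝓡 n) p).symm := by
    filter_upwards [hsrc] with z hz
    exact (extChartAt _ (χ p)).left_inv hz
  filter_upwards [hF1, hsrc, hinv.eventuallyEq_nhds,
    extChartAt_target_mem_nhds (I := 𝓡 n) p] with z hz1 hz2 hz3 hz4
  refine ⟨hz3.self_of_nhds, fun v => ?_⟩
  have hFz : F z ∈ (extChartAt (𝓘(ℝ, ℝ).prod (𝓡 n)) (χ p)).target :=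
    (extChartAt _ (χ p)).map_source hz2
  have h1 : MDifferentiableAt 𝓘(ℝ, EuclideanSpace ℝ (Fin n)) (𝓡 n)
      (extChartAt (𝓡 n) p).symm z := by
    have := mdifferentiableWithinAt_extChartAt_symm (I := 𝓡 n) hz4
    rwa [(𝓡 n).range_eq_univ, mdifferentiableWithinAt_univ] at this
  have h2 : MDifferentiableAt 𝓘(ℝ, ℝ × EuclideanSpace ℝ (Fin n)) (𝓘(ℝ, ℝ).prod (𝓡 n))
      (extChartAt (𝓘(ℝ, ℝ).prod (𝓡 n)) (χ p)).symm (F z) := by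
    have := mdifferentiableWithinAt_extChartAt_symm (I := 𝓘(ℝ, ℝ).prod (𝓡 n)) hFz
    rwa [(𝓘(ℝ, ℝ).prod (𝓡 n)).range_eq_univ, mdifferentiableWithinAt_univ] at this
  have h3 := h2.hasMFDerivAt.comp z (hz1.differentiableAt (by simp)).hasFDerivAt.hasMFDerivAt
  have h4 := ((hχ ((extChartAt (𝓡 n) p).symm z)).mdifferentiableAt
    (by simp)).hasMFDerivAt.comp z h1.hasMFDerivAt
  have h5 := h3.congr_of_eventuallyEq hz3.symm
  have h6 := hasMFDerivAt_unique h5 h4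
  exact DFunLike.congr_fun h6 v

/-- In charts, the metric of the hypersurface is the pullback of the ambient metric. -/
theorem IsIsometricImmersion.chartMetric_eq (hχ : IsIsometricImmersion g h J χ) (p : M) :
    ∀ᶠ z in 𝓝 (extChartAt (𝓡 n) p p), ∀ v w, chartMetric (𝓡 n) g p z v w
      = chartMetric (𝓘(ℝ, ℝ).prod (𝓡 n)) h (χ p)
        (writtenInExtChartAt (𝓡 n) (𝓘(ℝ, ℝ).prod (𝓡 n)) p χ z)
        (fderiv ℝ (writtenInExtChartAt (𝓡 n) (𝓘(ℝ, ℝ).prod (𝓡 n)) p χ) z v)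
        (fderiv ℝ (writtenInExtChartAt (𝓡 n) (𝓘(ℝ, ℝ).prod (𝓡 n)) p χ) z w) := by
  filter_upwards [chartFrame_fderiv_writtenInExtChartAt hχ.smooth p] with z hz v w
  simp only [chartMetric, bilinearComp_apply, hz.1, hz.2, hχ.isometric]

omit [IsManifold (𝓡 n) ∞ X] [IsManifold (𝓡 n) ∞ M] in
theorem IsIsometricImmersion.injective_differential (hg : IsRiemannianMetric g)
    (hχ : IsIsometricImmersion g h J χ) (p : M) :
    Function.Injective (differential (n := n) χ p) := by
  refine (injective_iff_map_eq_zero _).2 fun u hu => ?_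
  by_contra hne
  refine (hg.pos p u hne).ne' ?_
  rw [← hχ.isometric, hu, map_zero]

/-- A hyperplane in a Euclidean space has a unit normal vector, which spans the normal space. -/
theorem exists_unitNormal {E W : Type*} [NormedAddCommGroup E] [NormedSpace ℝ E]
    [FiniteDimensional ℝ E] [NormedAddCommGroup W] [NormedSpace ℝ W] [FiniteDimensional ℝ W]
    {B : W →L[ℝ] W →L[ℝ] ℝ} (hs : ∀ v w, B v w = B w v) (hB : ∀ v, v ≠ 0 → 0 < B v v)
    {A : E →L[ℝ] W} (hA : Function.Injective A)
    (hdim : Module.finrank ℝ W = Module.finrank ℝ E + 1) :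
    ∃ ν, B ν ν = 1 ∧ (∀ u, B (A u) ν = 0) ∧ ∀ N, (∀ u, B N (A u) = 0) → N = B N ν • ν := by
  obtain ⟨N₀, hN₀, hne⟩ : ∃ N : W, (∀ u, B N (A u) = 0) ∧ N ≠ 0 := by
    let L : W →ₗ[ℝ] Module.Dual ℝ E :=
      (LinearMap.lcomp ℝ ℝ (A : E →ₗ[ℝ] W)) ∘ₗ (ContinuousLinearMap.coeLM ℝ) ∘ₗ
        (B : W →ₗ[ℝ] W →L[ℝ] ℝ)
    have hL : LinearMap.ker L ≠ ⊥ :=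
      LinearMap.ker_ne_bot_of_finrank_lt (by rw [Subspace.dual_finrank_eq, hdim]; omega)
    obtain ⟨N, hN, hne⟩ := (Submodule.ne_bot_iff _).1 hL
    exact ⟨N, fun u => DFunLike.congr_fun (LinearMap.mem_ker.1 hN) u, hne⟩
  have hpos := hB N₀ hne
  set r := Real.sqrt (B N₀ N₀) with hr
  have hr0 : 0 < r := Real.sqrt_pos.2 hpos
  have hrr : B N₀ N₀ = r * r := (Real.mul_self_sqrt hpos.le).symm
  set ν := r⁻¹ • N₀ with hν
  have h1 : B ν ν = 1 := by
    simp only [hν, map_smul, smul_apply, smul_eq_mul, hrr]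
    field_simp
  have h2 : ∀ u, B (A u) ν = 0 := fun u => by
    rw [hs, hν, map_smul, smul_apply, hN₀, smul_zero]
  refine ⟨ν, h1, h2, fun N hN => ?_⟩
  -- By dimension, the image of `A` and `ν` span `W`.
  let T : E × ℝ →ₗ[ℝ] W := (A : E →ₗ[ℝ] W).coprod (LinearMap.toSpanSingleton ℝ W ν)
  have hT : ∀ z : E × ℝ, T z = A z.1 + z.2 • ν := fun z => by simp [T]
  have hTinj : Function.Injective T := by
    rw [← LinearMap.ker_eq_bot, LinearMap.ker_eq_bot']
    rintro ⟨x, s⟩ hx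
    rw [hT] at hx
    have h3 := congrArg (fun w => B w ν) hx
    simp only [map_add, add_apply, h2, map_smul, smul_apply, h1, map_zero, zero_apply,
      smul_eq_mul, mul_one, zero_add] at h3
    subst h3
    rw [zero_smul, add_zero] at hx
    exact Prod.ext (hA (hx.trans (map_zero A).symm)) rfl
  have hTsurj : Function.Surjective T :=
    (LinearMap.injective_iff_surjective_of_finrank_eq_finrank (by simp [hdim])).1 hTinj
  obtain ⟨z, hz⟩ := hTsurj (N - B N ν • ν)
  by_contra hne'
  have h4 : N - B N ν • ν ≠ 0 := sub_ne_zero.2 hne'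
  refine (hB _ h4).ne' ?_
  nth_rewrite 2 [← hz]
  rw [hT]
  simp only [map_add, map_sub, map_smul, sub_apply, smul_apply, hN, h1, smul_eq_mul,
    hs ν (A z.1), h2]
  ring

/-- The Gauss equation of a totally umbilical hypersurface: at a given point, the sectional
curvatures of the hypersurface exceed those of the ambient space by a constant, the square of the
principal curvature. -/
theorem IsIsometricImmersion.exists_curvature_eq (hg : IsRiemannianMetric g)
    (hχ : IsIsometricImmersion g h J χ) (hU : IsTotallyUmbilical g h χ) (p : M)
    (hH : IsMetricNear (chartMetric (𝓘(ℝ, ℝ).prod (𝓡 n)) h (χ p))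
      (extChartAt (𝓘(ℝ, ℝ).prod (𝓡 n)) (χ p) (χ p))) :
    ∃ m : ℝ, ∀ u v, g p (curvatureAt (𝓡 n) g p u v v) u =
      h (χ p) (curvatureAt (𝓘(ℝ, ℝ).prod (𝓡 n)) h (χ p) (differential χ p u)
        (differential χ p v) (differential χ p v)) (differential χ p u)
      + m * (g p u u * g p v v - g p u v ^ 2) := by
  have hFy : writtenInExtChartAt (𝓡 n) (𝓘(ℝ, ℝ).prod (𝓡 n)) p χ (extChartAt (𝓡 n) p p)
      = extChartAt (𝓘(ℝ, ℝ).prod (𝓡 n)) (χ p) (χ p) := by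
    simp only [writtenInExtChartAt, Function.comp_apply, extChartAt_to_inv]
  have hF := (contDiffAt_writtenInExtChartAt hχ.smooth p).of_le
    (show ((3 : ℕ∞) : WithTop ℕ∞) ≤ ∞ from WithTop.coe_le_coe.2 le_top)
  have hDF := fderiv_writtenInExtChartAt hχ.smooth p
  have hGH := hχ.chartMetric_eq p
  have hG := hg.isMetricNear p
  have hsym : ∀ v w, h (χ p) v w = h (χ p) w v := by
    have := hH.symm.self_of_nhds
    rwa [chartMetric_self] at this
  have hpos : ∀ v, v ≠ 0 → 0 < h (χ p) v v := by
    have := hH.pos.self_of_nhds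
    rwa [chartMetric_self] at this
  obtain ⟨ν, hν1, hν2, hν3⟩ := exists_unitNormal hsym hpos
    (hχ.injective_differential hg p) (by simp [add_comm])
  obtain ⟨μ, hμ⟩ := hU p ν ⟨hν1, hν2⟩
  rw [← hFy] at hH
  have hort := secondForm_orthogonal hG hH hF hGH
  have hgauss := gauss_equation hG hH hF hGH
  simp only [hDF, hFy, chartMetric_self] at hort hgauss
  -- The second derivative differs from the second fundamental form by a tangent vector.
  have hII : ∀ u v, secondForm (chartMetric (𝓡 n) g p)
      (chartMetric (𝓘(ℝ, ℝ).prod (𝓡 n)) h (χ p))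
      (writtenInExtChartAt (𝓡 n) (𝓘(ℝ, ℝ).prod (𝓡 n)) p χ) (extChartAt (𝓡 n) p p) u v
      = (μ * g p u v) • ν := by
    intro u v
    rw [hν3 _ (hort u v)]
    congr 1
    have h1 := hμ u v
    rw [smul_apply, id_apply, map_smul, smul_apply, smul_eq_mul] at h1
    rw [h1, secondForm, hFy, hDF, map_sub, sub_apply, hν2, sub_zero]
    rfl
  refine ⟨μ ^ 2, fun u v => ?_⟩
  have h2 := hgauss u v v u
  simp only [hII, map_smul, smul_apply, smul_eq_mul, hν1] at h2
  rw [curvatureAt, curvatureAt, h2, hg.symm p v u]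
  ring

end Immersion

/-! ### Einstein hypersurfaces of warped products -/

section Ricci

section Trace

variable {E : Type*} [NormedAddCommGroup E] [NormedSpace ℝ E] [FiniteDimensional ℝ E]
  {B : E →L[ℝ] E →L[ℝ] ℝ}

theorem exists_orthonormal_basis_of_pos (hs : ∀ v w, B v w = B w v)
    (hB : ∀ v, v ≠ 0 → 0 < B v v) :
    ∃ b : Module.Basis (Fin (Module.finrank ℝ E)) ℝ E,
      (∀ i, B (b i) (b i) = 1) ∧ ∀ i j, i ≠ j → B (b i) (b j) = 0 := by
  let B' : LinearMap.BilinForm ℝ E := (ContinuousLinearMap.coeLM ℝ) ∘ₗ (B : E →ₗ[ℝ] E →L[ℝ] ℝ)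
  have hB' : ∀ v w, B' v w = B v w := fun v w => rfl
  obtain ⟨b, hb⟩ := LinearMap.BilinForm.exists_orthogonal_basis (B := B') ⟨fun v w => hs v w⟩
  have hpos : ∀ i, 0 < B (b i) (b i) := fun i => hB _ (b.ne_zero i)
  have hu : ∀ i, IsUnit (Real.sqrt (B (b i) (b i)))⁻¹ := fun i =>
    (inv_ne_zero (Real.sqrt_pos.2 (hpos i)).ne').isUnit
  refine ⟨b.isUnitSMul hu, fun i => ?_, fun i j hij => ?_⟩
  · simp only [Module.Basis.isUnitSMul_apply, map_smul, smul_apply, smul_eq_mul]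
    rw [← mul_assoc, ← mul_inv, Real.mul_self_sqrt (hpos i).le, inv_mul_cancel₀ (hpos i).ne']
  · have : B (b i) (b j) = 0 := hb hij
    simp only [Module.Basis.isUnitSMul_apply, map_smul, smul_apply, smul_eq_mul, this, mul_zero]

/-- The trace, over the first argument, of a curvature-like form whose sectional curvatures are
those of a space form plus a rank one correction. -/
theorem trace_eq_of_forall (hs : ∀ v w, B v w = B w v) (hB : ∀ v, v ≠ 0 → 0 < B v v)
    (τ : E →L[ℝ] ℝ) (k d : ℝ) : ∃ S : ℝ, ∀ (L : E →ₗ[ℝ] E) (v : E),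
      (∀ u, B (L u) u = k * (B u u * B v v - B u v ^ 2)
        + d * (τ u ^ 2 * B v v - 2 * τ u * τ v * B u v + τ v ^ 2 * B u u)) →
      LinearMap.trace ℝ E L = S * B v v + d * (Module.finrank ℝ E - 2) * τ v ^ 2 := by
  obtain ⟨b, hb1, hb0⟩ := exists_orthonormal_basis_of_pos hs hB
  have hrepr : ∀ x i, b.repr x i = B x (b i) := by
    intro x i
    conv_rhs => rw [← b.sum_repr x]
    rw [map_sum, sum_apply, Finset.sum_eq_single i]
    · rw [map_smul, smul_apply, hb1, smul_eq_mul, mul_one]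
    · intro j _ hj
      rw [map_smul, smul_apply, hb0 j i hj, smul_zero]
    · simp
  have hsum : ∀ (l : E →L[ℝ] ℝ) x, ∑ i, B x (b i) * l (b i) = l x := by
    intro l x
    conv_rhs => rw [← b.sum_repr x]
    rw [map_sum]
    exact Finset.sum_congr rfl fun i _ => by rw [map_smul, hrepr, smul_eq_mul]
  refine ⟨k * (Module.finrank ℝ E - 1) + d * ∑ i, τ (b i) ^ 2, fun L v hL => ?_⟩
  rw [LinearMap.trace_eq_matrix_trace ℝ b, Matrix.trace]
  have h1 : ∀ i, (LinearMap.toMatrix b b L).diag i = k * B v v - k * (B v (b i) * B v (b i))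
      + d * B v v * τ (b i) ^ 2 - 2 * d * τ v * (B v (b i) * τ (b i)) + d * τ v ^ 2 := by
    intro i
    rw [Matrix.diag_apply, LinearMap.toMatrix_apply, hrepr, hL, hb1, hs (b i) v]
    ring
  simp only [h1, Finset.sum_add_distrib, Finset.sum_sub_distrib, ← Finset.mul_sum, hsum,
    Finset.sum_const, Finset.card_univ, Fintype.card_fin, nsmul_eq_mul]
  ring

end Trace

variable {n : ℕ} {X : Type*} [TopologicalSpace X] [ChartedSpace (EuclideanSpace ℝ (Fin n)) X]
  [IsManifold (𝓡 n) ∞ X] {M : Type*} [TopologicalSpace M]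
  [ChartedSpace (EuclideanSpace ℝ (Fin n)) M] [IsManifold (𝓡 n) ∞ M]
  {f : ℝ → ℝ} {J : Set ℝ} {χ : M → ℝ × X}
  {g : M → EuclideanSpace ℝ (Fin n) →L[ℝ] EuclideanSpace ℝ (Fin n) →L[ℝ] ℝ}
  {gX : X → EuclideanSpace ℝ (Fin n) →L[ℝ] EuclideanSpace ℝ (Fin n) →L[ℝ] ℝ}

/-- The Ricci curvature is a trace, hence can be computed in any basis. -/
theorem IsRiemannianMetric.exists_ricciCurvature_eq_trace (hg : IsRiemannianMetric g) (p : M)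
    (v w : EuclideanSpace ℝ (Fin n)) :
    ∃ L : EuclideanSpace ℝ (Fin n) →ₗ[ℝ] EuclideanSpace ℝ (Fin n),
      (∀ u, L u = curvatureAt (𝓡 n) g p u v w) ∧
      ricciCurvature g p v w = LinearMap.trace ℝ _ L := by
  have hlin := fun u => (hg.isMetricNear p).coordCurvature_eq u v w
  let L : EuclideanSpace ℝ (Fin n) →ₗ[ℝ] EuclideanSpace ℝ (Fin n) :=
    { toFun := fun u => curvatureAt (𝓡 n) g p u v w
      map_add' := fun a b => by
        simp only [curvatureAt, hlin, map_add, add_apply]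
        abel
      map_smul' := fun a b => by
        simp only [curvatureAt, hlin, map_smul, smul_apply, RingHom.id_apply, smul_sub, smul_add] }
  refine ⟨L, fun u => rfl, ?_⟩
  rw [LinearMap.trace_eq_matrix_trace ℝ (EuclideanSpace.basisFun (Fin n) ℝ).toBasis, Matrix.trace,
    ricciCurvature]
  refine Finset.sum_congr rfl fun i _ => ?_
  rw [Matrix.diag_apply, LinearMap.toMatrix_apply]
  simp [L]

/-- Wherever the radial and the tangential curvature of the warped product differ, a totally
umbilical Einstein hypersurface is tangent to the slice: the Ricci curvature in the direction `v`
is a multiple of `g(v, v)` plus a nonzero multiple of `dt(v)²`. -/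
theorem IsIsometricImmersion.differential_fst_eq_zero (hn : 3 ≤ n) (hg : IsRiemannianMetric g)
    (hgX : IsRiemannianMetric gX) {c : ℝ} (hc : HasConstantCurvatureOn (𝓡 n) gX c Set.univ)
    (hχ : IsIsometricImmersion g (warpedMetric f gX) J χ) (hE : IsEinstein g)
    (hU : IsTotallyUmbilical g (warpedMetric f gX) χ) (p : M)
    (hf : ContDiffAt ℝ 2 f (χ p).1) (hfpos : 0 < f (χ p).1)
    (hne : - deriv (deriv f) (χ p).1 / f (χ p).1 ≠
      (c - deriv f (χ p).1 ^ 2) / f (χ p).1 ^ 2) (u : EuclideanSpace ℝ (Fin n)) :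
    (differential χ p u).1 = 0 := by
  have hH : IsMetricNear (chartMetric (𝓘(ℝ, ℝ).prod (𝓡 n)) (warpedMetric f gX) (χ p))
      (extChartAt (𝓘(ℝ, ℝ).prod (𝓡 n)) (χ p) (χ p)) := by
    refine IsMetricNear.congr ?_ (chartMetric_warpedMetric (χ p))
    rw [extChartAt_real_prod]
    exact hgX.isMetricNear_warped (χ p) hf hfpos
  obtain ⟨m, hm⟩ := hχ.exists_curvature_eq hg hU p hH
  obtain ⟨ρ, hρ⟩ := hE
  set kt := (c - deriv f (χ p).1 ^ 2) / f (χ p).1 ^ 2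
  set kr := - deriv (deriv f) (χ p).1 / f (χ p).1
  let τ : EuclideanSpace ℝ (Fin n) →L[ℝ] ℝ :=
    (ContinuousLinearMap.fst ℝ ℝ (EuclideanSpace ℝ (Fin n))).comp (differential χ p)
  obtain ⟨S, hS⟩ := trace_eq_of_forall (hg.symm p) (hg.pos p) τ (kt + m) (kr - kt)
  have hric : ∀ v, ρ * g p v v = S * g p v v + (kr - kt) * (n - 2) * τ v ^ 2 := by
    intro v
    obtain ⟨L, hL, htr⟩ := hg.exists_ricciCurvature_eq_trace p v v
    rw [← hρ, htr, hS L v fun u => ?_, finrank_euclideanSpace_fin]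
    rw [hL, hm, hgX.curvature_warped hc (χ p) hf hfpos]
    simp only [hχ.isometric]
    change _ = (kt + m) * _ + (kr - kt) * ((differential χ p u).1 ^ 2 * _
      - 2 * (differential χ p u).1 * (differential χ p v).1 * _ + (differential χ p v).1 ^ 2 * _)
    ring
  -- A vector tangent to the slice determines the coefficient of the metric.
  obtain ⟨v, hv, hv0⟩ := (Submodule.ne_bot_iff _).1
    (LinearMap.ker_ne_bot_of_finrank_lt (f := (τ : EuclideanSpace ℝ (Fin n) →ₗ[ℝ] ℝ))
      (by rw [finrank_euclideanSpace_fin, Module.finrank_self]; omega))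
  have hv1 : τ v = 0 := hv
  have hρS : ρ = S := by
    have := hric v
    rw [hv1] at this
    exact mul_right_cancel₀ (hg.pos p v hv0).ne' (by linarith)
  have h3 := hric u
  rw [hρS, left_eq_add] at h3
  have hn' : (n : ℝ) - 2 ≠ 0 := by
    have : (3 : ℝ) ≤ n := by exact_mod_cast hn
    linarith
  exact (pow_eq_zero_iff two_ne_zero).1
    ((mul_eq_zero.1 h3).resolve_left (mul_ne_zero (sub_ne_zero.2 hne) hn'))

end Ricci

/-! ### The inverse function theorem on manifolds -/

section LocalDiffeomorph

variable {n : ℕ}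

/-- The inverse function theorem in Euclidean space, with a smooth inverse. -/
theorem exists_partialDiffeomorph_of_injective_fderiv
    {F : EuclideanSpace ℝ (Fin n) → EuclideanSpace ℝ (Fin n)}
    {s : Set (EuclideanSpace ℝ (Fin n))} (hs : IsOpen s) (hF : ContDiffOn ℝ ∞ F s)
    {y : EuclideanSpace ℝ (Fin n)} (hy : y ∈ s) (hinj : Function.Injective (fderiv ℝ F y)) :
    ∃ Φ : PartialDiffeomorph (𝓡 n) (𝓡 n) (EuclideanSpace ℝ (Fin n)) (EuclideanSpace ℝ (Fin n)) ∞,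
      y ∈ Φ.source ∧ Φ.source ⊆ s ∧ ∀ z, Φ z = F z := by
  have hat : ∀ z ∈ s, ContDiffAt ℝ ∞ F z := fun z hz => hF.contDiffAt (hs.mem_nhds hz)
  let A : EuclideanSpace ℝ (Fin n) ≃L[ℝ] EuclideanSpace ℝ (Fin n) :=
    (LinearEquiv.ofInjectiveEndo (fderiv ℝ F y : EuclideanSpace ℝ (Fin n) →ₗ[ℝ] _)
      hinj).toContinuousLinearEquiv
  have hA : (A : EuclideanSpace ℝ (Fin n) →L[ℝ] EuclideanSpace ℝ (Fin n)) = fderiv ℝ F y := by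
    ext1 v; rfl
  have hder : HasFDerivAt F
      (A : EuclideanSpace ℝ (Fin n) →L[ℝ] EuclideanSpace ℝ (Fin n)) y := by
    rw [hA]; exact ((hat y hy).differentiableAt (by simp)).hasFDerivAt
  set e := (hat y hy).toOpenPartialHomeomorph F hder (by simp) with he
  -- The inverse is smooth where the derivative of `F` stays invertible.
  let U := s ∩ fderiv ℝ F ⁻¹' Set.range
    ((↑) : (EuclideanSpace ℝ (Fin n) ≃L[ℝ] EuclideanSpace ℝ (Fin n)) → _)
  have hU : IsOpen U :=
    (hF.continuousOn_fderiv_of_isOpen hs (by simp)).isOpen_inter_preimage hs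
      ContinuousLinearEquiv.isOpen
  let e' := e.restrOpen U hU
  have hsrc : e'.source = e.source ∩ U := e.restrOpen_source U hU
  refine ⟨⟨e'.toPartialEquiv, e'.open_source, e'.open_target, ?_, ?_⟩, ?_, ?_, fun z => rfl⟩
  · refine contMDiffOn_iff_contDiffOn.2 (hF.mono ?_)
    rw [hsrc]
    exact fun z hz => hz.2.1
  · refine contMDiffOn_iff_contDiffOn.2 fun z hz => ?_
    have h1 : e'.symm z ∈ e'.source := e'.map_target hz
    rw [hsrc] at h1
    obtain ⟨B, hB⟩ := h1.2.2
    refine (e'.contDiffAt_symm (f₀' := B) hz ?_ (hat _ h1.2.1)).contDiffWithinAt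
    rw [hB]
    exact ((hat _ h1.2.1).differentiableAt (by simp)).hasFDerivAt
  · change y ∈ e'.source
    rw [hsrc]
    exact ⟨(hat y hy).mem_toOpenPartialHomeomorph_source hder (by simp), hy, A, hA⟩
  · change e'.source ⊆ s
    rw [hsrc]
    exact fun z hz => hz.2.1

variable {X : Type*} [TopologicalSpace X] [ChartedSpace (EuclideanSpace ℝ (Fin n)) X]
  [IsManifold (𝓡 n) ∞ X]

/-- The preferred chart as a diffeomorphism. -/
def chartPartialDiffeomorph (p : X) :
    PartialDiffeomorph (𝓡 n) (𝓡 n) X (EuclideanSpace ℝ (Fin n)) ∞ where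
  toPartialEquiv := (chartAt (EuclideanSpace ℝ (Fin n)) p).toPartialEquiv
  open_source := (chartAt (EuclideanSpace ℝ (Fin n)) p).open_source
  open_target := (chartAt (EuclideanSpace ℝ (Fin n)) p).open_target
  contMDiffOn_toFun := contMDiffOn_chart
  contMDiffOn_invFun := contMDiffOn_chart_symm

variable {M : Type*} [TopologicalSpace M]
  [ChartedSpace (EuclideanSpace ℝ (Fin n)) M] [IsManifold (𝓡 n) ∞ M]

/-- The inverse function theorem on manifolds. -/
theorem isLocalDiffeomorph_of_injective_mfderiv {F : M → X} (hF : ContMDiff (𝓡 n) (𝓡 n) ∞ F)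
    (hinj : ∀ p, Function.Injective (mfderiv (𝓡 n) (𝓡 n) F p)) :
    IsLocalDiffeomorph (𝓡 n) (𝓡 n) ∞ F := by
  intro p
  let a := chartAt (EuclideanSpace ℝ (Fin n)) p
  let b := chartAt (EuclideanSpace ℝ (Fin n)) (F p)
  let s := a.target ∩ a.symm ⁻¹' (F ⁻¹' b.source)
  have hs : IsOpen s := a.symm.isOpen_inter_preimage (b.open_source.preimage hF.continuous)
  have hFs : ContDiffOn ℝ ∞ (b ∘ F ∘ a.symm) s := by
    refine contMDiffOn_iff_contDiffOn.1 ?_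
    exact (contMDiffOn_chart (I := 𝓡 n) (x := F p)).comp (hF.comp_contMDiffOn
      (contMDiffOn_chart_symm.mono Set.inter_subset_left)) fun z hz => hz.2
  have hmem : a p ∈ s := ⟨mem_chart_target _ p, by
    change F (a.symm (a p)) ∈ b.source
    rw [a.left_inv (mem_chart_source _ p)]
    exact mem_chart_source _ (F p)⟩
  have hder : fderiv ℝ (b ∘ F ∘ a.symm) (a p) = mfderiv (𝓡 n) (𝓡 n) F p := by
    rw [((hF p).mdifferentiableAt (by simp)).mfderiv, (𝓡 n).range_eq_univ, fderivWithin_univ]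
    rfl
  obtain ⟨Φ, h1, h2, h3⟩ := exists_partialDiffeomorph_of_injective_fderiv hs hFs hmem
    (by rw [hder]; exact hinj p)
  have h4 : ∀ z ∈ Φ.source, Φ z ∈ b.target := fun z hz => by
    rw [h3]
    exact b.map_source (h2 hz).2
  refine ⟨((chartPartialDiffeomorph p).trans Φ).trans (chartPartialDiffeomorph (F p)).symm,
    ⟨⟨mem_chart_source _ p, h1⟩, h4 _ h1⟩, fun q hq => ?_⟩
  have hq1 : q ∈ a.source := hq.1.1
  have hq2 : a q ∈ Φ.source := hq.1.2
  change F q = b.symm (Φ (a q))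
  have h5 : F (a.symm (a q)) ∈ b.source := (h2 hq2).2
  rw [a.left_inv hq1] at h5
  rw [h3, Function.comp_apply, Function.comp_apply, a.left_inv hq1, b.left_inv h5]

end LocalDiffeomorph

/-! ### The height function -/

section Height

variable {n : ℕ} {X : Type*} [TopologicalSpace X] [ChartedSpace (EuclideanSpace ℝ (Fin n)) X]
  [IsManifold (𝓡 n) ∞ X] {M : Type*} [TopologicalSpace M]
  [ChartedSpace (EuclideanSpace ℝ (Fin n)) M] [IsManifold (𝓡 n) ∞ M]
  {f : ℝ → ℝ} {J : Set ℝ} {χ : M → ℝ × X}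
  {g : M → EuclideanSpace ℝ (Fin n) →L[ℝ] EuclideanSpace ℝ (Fin n) →L[ℝ] ℝ}
  {gX : X → EuclideanSpace ℝ (Fin n) →L[ℝ] EuclideanSpace ℝ (Fin n) →L[ℝ] ℝ}

omit [IsManifold (𝓡 n) ∞ X] in
/-- The height function in a chart, and its differential. -/
theorem hasFDerivAt_fst_comp (hχ : ContMDiff (𝓡 n) (𝓘(ℝ, ℝ).prod (𝓡 n)) ∞ χ) (p : M)
    {z : EuclideanSpace ℝ (Fin n)} (hz : z ∈ (extChartAt (𝓡 n) p).target) :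
    HasFDerivAt (fun z => (χ ((extChartAt (𝓡 n) p).symm z)).1)
      ((ContinuousLinearMap.fst ℝ ℝ (EuclideanSpace ℝ (Fin n))).comp
        ((differential χ ((extChartAt (𝓡 n) p).symm z)).comp (chartFrame (𝓡 n) p z))) z := by
  have h1 : MDifferentiableAt 𝓘(ℝ, EuclideanSpace ℝ (Fin n)) (𝓡 n)
      (extChartAt (𝓡 n) p).symm z := by
    have := mdifferentiableWithinAt_extChartAt_symm (I := 𝓡 n) hz
    rwa [(𝓡 n).range_eq_univ, mdifferentiableWithinAt_univ] at this
  have h4 := ((hχ ((extChartAt (𝓡 n) p).symm z)).mdifferentiableAt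
    (by simp)).hasMFDerivAt.comp z h1.hasMFDerivAt
  exact (HasMFDerivAt.comp z (hasMFDerivAt_fst _) h4).hasFDerivAt

omit [IsManifold (𝓡 n) ∞ X] in
theorem contDiffOn_fst_comp (hχ : ContMDiff (𝓡 n) (𝓘(ℝ, ℝ).prod (𝓡 n)) ∞ χ) (p : M) :
    ContDiffOn ℝ ∞ (fun z => (χ ((extChartAt (𝓡 n) p).symm z)).1)
      (extChartAt (𝓡 n) p).target :=
  contMDiffOn_iff_contDiffOn.1
    (contMDiff_fst.comp_contMDiffOn (hχ.comp_contMDiffOn (contMDiffOn_extChartAt_symm p)))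

/-- Where the height function has a nonzero differential it is open, so its values near such a
point fill an interval, on which the warped product would have constant curvature. -/
theorem IsIsometricImmersion.differential_fst_eq_zero_of_not_constant (hn : 3 ≤ n)
    (hg : IsRiemannianMetric g) (hgX : IsRiemannianMetric gX) {c : ℝ}
    (hc : HasConstantCurvatureOn (𝓡 n) gX c Set.univ) (hJ : IsOpen J)
    (hf : ContDiffOn ℝ ∞ f J) (hfpos : ∀ t ∈ J, 0 < f t)
    (hnc : ∀ W : Set (ℝ × X), IsOpen W → W.Nonempty → W ⊆ J ×ˢ Set.univ →
      ¬ ∃ κ : ℝ, HasConstantCurvatureOn (𝓘(ℝ, ℝ).prod (𝓡 n)) (warpedMetric f gX) κ W)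
    (hχ : IsIsometricImmersion g (warpedMetric f gX) J χ) (hE : IsEinstein g)
    (hU : IsTotallyUmbilical g (warpedMetric f gX) χ) (p : M) (u : EuclideanSpace ℝ (Fin n)) :
    (differential χ p u).1 = 0 := by
  by_contra hne
  have hf2 : ContDiffOn ℝ 2 f J := hf.of_le (WithTop.coe_le_coe.2 le_top)
  -- The heights at which the radial and the tangential curvature agree.
  set S := {t | - deriv (deriv f) t / f t = (c - deriv f t ^ 2) / f t ^ 2}
  set φ := fun z => (χ ((extChartAt (𝓡 n) p).symm z)).1
  have hφ := contDiffOn_fst_comp hχ.smooth p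
  have hopen := isOpen_extChartAt_target (I := 𝓡 n) p
  have hφp : φ (extChartAt (𝓡 n) p p) = (χ p).1 := by simp only [φ, extChartAt_to_inv]
  have hfd : ∀ z ∈ (extChartAt (𝓡 n) p).target, ∀ v, fderiv ℝ φ z v
      = (differential χ ((extChartAt (𝓡 n) p).symm z) (chartFrame (𝓡 n) p z v)).1 :=
    fun z hz v => by rw [(hasFDerivAt_fst_comp hχ.smooth p hz).fderiv]; rfl
  have hne' : fderiv ℝ φ (extChartAt (𝓡 n) p p) u ≠ 0 := by
    rw [hfd _ (mem_extChartAt_target p), chartFrame_self, extChartAt_to_inv]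
    exact hne
  have hev : ∀ᶠ z in 𝓝 (extChartAt (𝓡 n) p p), φ z ∈ S := by
    have hcont : ContinuousAt (fun z => fderiv ℝ φ z u) (extChartAt (𝓡 n) p p) :=
      (((hφ.continuousOn_fderiv_of_isOpen hopen (by simp)).continuousAt
        (extChartAt_target_mem_nhds p))).clm_apply continuousAt_const
    filter_upwards [hcont.eventually_ne hne', extChartAt_target_mem_nhds (I := 𝓡 n) p]
      with z hz1 hz2
    by_contra hzS
    refine hz1 ?_
    rw [hfd z hz2]
    exact hχ.differential_fst_eq_zero hn hg hgX hc hE hU _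
      (hf2.contDiffAt (hJ.mem_nhds (hχ.mem _))) (hfpos _ (hχ.mem _)) hzS _
  have hmap : map φ (𝓝 (extChartAt (𝓡 n) p p)) = 𝓝 (χ p).1 := by
    rw [← hφp]
    refine ((hφ.contDiffAt (extChartAt_target_mem_nhds p)).hasStrictFDerivAt
      (by simp)).map_nhds_eq_of_surj ?_
    refine LinearMap.range_eq_top.2 fun r => ⟨(r / fderiv ℝ φ (extChartAt (𝓡 n) p p) u) • u, ?_⟩
    change fderiv ℝ φ _ _ = r
    rw [map_smul, smul_eq_mul, div_mul_cancel₀ _ hne']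
  have hS : S ∈ 𝓝 (χ p).1 := by rw [← hmap]; exact hev
  obtain ⟨ε, hε, hball⟩ := Metric.mem_nhds_iff.1 (inter_mem hS (hJ.mem_nhds (hχ.mem p)))
  have hsub : Metric.ball (χ p).1 ε ⊆ J := fun t ht => (hball ht).2
  refine hnc (Metric.ball (χ p).1 ε ×ˢ Set.univ) (Metric.isOpen_ball.prod isOpen_univ)
    ⟨χ p, Metric.mem_ball_self hε, Set.mem_univ _⟩ (Set.prod_mono hsub subset_rfl) ?_
  exact hgX.exists_hasConstantCurvatureOn_warped hc Metric.isOpen_ball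
    (convex_ball _ _).ordConnected (hf2.mono hsub) (fun t ht => hfpos t (hsub ht))
    fun t ht => (hball ht).1

omit [IsManifold (𝓡 n) ∞ X] in
/-- A connected hypersurface tangent to the slices lies in a slice. -/
theorem exists_height_eq [ConnectedSpace M]
    (hχ : ContMDiff (𝓡 n) (𝓘(ℝ, ℝ).prod (𝓡 n)) ∞ χ)
    (h0 : ∀ p (u : EuclideanSpace ℝ (Fin n)), (differential χ p u).1 = 0) :
    ∃ t₀, ∀ p, (χ p).1 = t₀ := by
  have hloc : IsLocallyConstant fun p => (χ p).1 := by
    refine (IsLocallyConstant.iff_eventually_eq _).2 fun p => ?_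
    obtain ⟨ε, hε, hball⟩ := Metric.mem_nhds_iff.1 (extChartAt_target_mem_nhds (I := 𝓡 n) p)
    filter_upwards [extChartAt_source_mem_nhds (I := 𝓡 n) p,
      (continuousAt_extChartAt (I := 𝓡 n) p).eventually (Metric.ball_mem_nhds _ hε)] with q hq1 hq2
    have h := Metric.isOpen_ball.is_const_of_fderiv_eq_zero (𝕜 := ℝ)
      (convex_ball _ _).isPreconnected
      (fun z hz => (hasFDerivAt_fst_comp hχ p (hball hz)).differentiableAt.differentiableWithinAt)
      (fun z hz => (hasFDerivAt_fst_comp hχ p (hball hz)).fderiv.trans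
        (ContinuousLinearMap.ext fun v => h0 _ _)) hq2 (Metric.mem_ball_self hε)
    simpa only [extChartAt_to_inv, (extChartAt (𝓡 n) p).left_inv hq1] using h
  exact ⟨_, fun p => hloc.apply_eq_of_preconnectedSpace p (Classical.arbitrary M)⟩

omit [IsManifold (𝓡 n) ∞ X] [IsManifold (𝓡 n) ∞ M] in
theorem mfderiv_snd_comp (hχ : ContMDiff (𝓡 n) (𝓘(ℝ, ℝ).prod (𝓡 n)) ∞ χ) (p : M)
    (u : EuclideanSpace ℝ (Fin n)) :
    mfderiv (𝓡 n) (𝓡 n) (fun p => (χ p).2) p u = (differential χ p u).2 := by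
  have h := (HasMFDerivAt.comp p (hasMFDerivAt_snd (I := 𝓘(ℝ, ℝ)) (I' := 𝓡 n) (χ p))
    ((hχ p).mdifferentiableAt (by simp)).hasMFDerivAt).mfderiv
  exact DFunLike.congr_fun h u

omit [IsManifold (𝓡 n) ∞ X] [IsManifold (𝓡 n) ∞ M] in
/-- A hypersurface tangent to the slices has the metric of a slice. -/
theorem IsIsometricImmersion.metric_eq_of_height_eq
    (hχ : IsIsometricImmersion g (warpedMetric f gX) J χ)
    (h0 : ∀ p (u : EuclideanSpace ℝ (Fin n)), (differential χ p u).1 = 0) {t₀ : ℝ}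
    (ht : ∀ p, (χ p).1 = t₀) (p : M) (u v : EuclideanSpace ℝ (Fin n)) :
    g p u v = f t₀ ^ 2 * gX (χ p).2 (mfderiv (𝓡 n) (𝓡 n) (fun p => (χ p).2) p u)
      (mfderiv (𝓡 n) (𝓡 n) (fun p => (χ p).2) p v) := by
  rw [← hχ.isometric, warpedMetric_apply, h0, zero_mul, zero_add, ht,
    mfderiv_snd_comp hχ.smooth, mfderiv_snd_comp hχ.smooth]

omit [IsManifold (𝓡 n) ∞ X] [IsManifold (𝓡 n) ∞ M] in
theorem tangentialPart_eq_zero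
    (h0 : ∀ p (u : EuclideanSpace ℝ (Fin n)), (differential χ p u).1 = 0) (p : M) :
    tangentialPart g (warpedMetric f gX) χ p = 0 := by
  have h1 : (warpedMetric f gX (χ p) (1, 0)).comp (differential χ p) = 0 := by
    ext1 u
    change warpedMetric f gX (χ p) (1, 0) (differential χ p u) = 0
    rw [warpedMetric_apply, h0]
    simp
  rw [tangentialPart, h1, map_zero]

end Height

end

/-! ### Covering maps and path lifting -/

section Covering

open Filter Topology

variable {X Y : Type*} [TopologicalSpace Y] {F : X → Y}

/-- A local homeomorphism is a covering map if it has sections with arbitrary initial values over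
the members of a cover by connected open sets. -/
theorem IsLocalHomeomorph.isCoveringMap_of_exists_section [TopologicalSpace X] [T2Space X]
    (hF : IsLocalHomeomorph F)
    (h : ∀ q, ∃ V : Set Y, IsOpen V ∧ q ∈ V ∧ IsPreconnected V ∧ ∀ x (hx : F x ∈ V),
      ∃ σ : V → X, Continuous σ ∧ (∀ v, F (σ v) = v) ∧ σ ⟨F x, hx⟩ = x) : IsCoveringMap F := by
  intro q
  obtain ⟨V, hV, hqV, hVc, hσ⟩ := h q
  have : PreconnectedSpace V := Subtype.preconnectedSpace hVc
  by_cases hemp : Nonempty (F ⁻¹' {q})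
  swap
  · refine (IsEvenlyCovered.of_preimage_eq_empty Empty (hV.mem_nhds hqV)
      (Set.eq_empty_of_forall_notMem fun x hx => ?_)).to_isEvenlyCovered_preimage
    obtain ⟨σ, -, hσ1, -⟩ := hσ x hx
    exact hemp ⟨⟨σ ⟨q, hqV⟩, hσ1 _⟩⟩
  have hx : ∀ x : F ⁻¹' {q}, F x ∈ V := fun x => by
    have : F x = q := x.2
    rwa [this]
  choose σ hσc hσF hσx using fun x : F ⁻¹' {q} => hσ x (hx x)
  have hσq : ∀ x : F ⁻¹' {q}, σ x ⟨q, hqV⟩ = x := fun x => by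
    rw [← hσx x]
    exact congrArg _ (Subtype.ext x.2.symm)
  have huniq : ∀ (s t : V → X), Continuous s → Continuous t → (∀ v, F (s v) = v) →
      (∀ v, F (t v) = v) → ∀ v, s v = t v → s = t := fun s t hs ht hsF htF v hv =>
    (T2Space.isSeparatedMap F).eq_of_comp_eq hF.isLocallyInjective hs ht
      (funext fun w => (hsF w).trans (htF w).symm) v hv
  have hopen : ∀ x, IsOpen (Set.range (σ x)) := fun x => by
    refine (IsLocalHomeomorph.of_comp ?_ hF (hσc x)).isOpenMap.isOpen_range
    have : F ∘ σ x = Subtype.val := funext fun v => hσF x v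
    rw [this]
    exact hV.isOpenEmbedding_subtypeVal.isLocalHomeomorph
  -- Sheets are indexed by the fiber, as a discrete space.
  let top : TopologicalSpace (F ⁻¹' {q}) := ⊥
  have hdisc : DiscreteTopology (F ⁻¹' {q}) := ⟨rfl⟩
  have hne : Nonempty (Y → X) := ⟨fun _ => hemp.some⟩
  refine (IsEvenlyCovered.of_trivialization (I := F ⁻¹' {q})
    (t := IsOpen.trivializationDiscrete (f := F) (fun x => Set.range (σ x)) V hV
      (fun x W hW => ⟨fun h => (h.preimage hF.continuous).inter (hopen x), fun h => ?_⟩)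
      ?_ ?_ ?_ ?_) hqV).to_isEvenlyCovered_preimage
  · have : W = F '' (F ⁻¹' W ∩ Set.range (σ x)) := by
      rw [Set.image_preimage_inter]
      refine (Set.inter_eq_left.2 fun w hw => ?_).symm
      exact ⟨_, ⟨⟨w, hW hw⟩, rfl⟩, hσF x _⟩
    rw [this]
    exact hF.isOpenMap _ h
  · rintro x _ ⟨v, rfl⟩ _ ⟨w, rfl⟩ hvw
    rw [hσF, hσF] at hvw
    rw [Subtype.ext hvw]
  · intro x v hv
    exact ⟨_, ⟨⟨v, hv⟩, rfl⟩, hσF x _⟩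
  · intro x y hxy
    refine Set.disjoint_left.2 ?_
    rintro _ ⟨v, rfl⟩ ⟨w, hw⟩
    have hvw : w = v := Subtype.ext (by rw [← hσF y w, hw, hσF])
    subst hvw
    have := congrFun (huniq _ _ (hσc y) (hσc x) (hσF y) (hσF x) w hw) ⟨q, hqV⟩
    rw [hσq, hσq] at this
    exact hxy (Subtype.ext this).symm
  · intro m hm
    obtain ⟨s, hsc, hsF, hsm⟩ := hσ m hm
    refine Set.mem_iUnion.2 ⟨⟨s ⟨q, hqV⟩, hsF _⟩, ⟨F m, hm⟩, ?_⟩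
    rw [← huniq s _ hsc (hσc _) hsF (hσF _) ⟨q, hqV⟩ (hσq ⟨s ⟨q, hqV⟩, hsF _⟩).symm,
      hsm]

/-- A covering of a simply connected space by a connected one has a single sheet. -/
theorem IsCoveringMap.bijective [TopologicalSpace X] [ConnectedSpace X] [SimplyConnectedSpace Y]
    [LocallyPathConnectedSpace Y] (hF : IsCoveringMap F) : Function.Bijective F := by
  let x₀ := Classical.arbitrary X
  obtain ⟨s, ⟨hs0, hs⟩, -⟩ := hF.existsUnique_continuousMap_lifts (ContinuousMap.id Y) (F x₀) x₀ rfl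
  have h1 : ∀ y, F (s y) = y := fun y => congrFun hs y
  have h2 : s ∘ F = id := hF.eq_of_comp_eq (s.continuous.comp hF.continuous) continuous_id
    (funext fun x => h1 (F x)) x₀ hs0
  exact ⟨Function.LeftInverse.injective (g := s) fun x => congrFun h2 x, fun y => ⟨s y, h1 y⟩⟩

/-- A path lifts through a local homeomorphism of a complete space if lifts over initial segments
are Lipschitz. -/
theorem IsLocalHomeomorph.exists_lift_of_lipschitz [MetricSpace X] [CompleteSpace X] [T2Space Y]
    (hF : IsLocalHomeomorph F) {γ : ℝ → Y} (hγ : ContinuousOn γ (Set.Icc 0 1)) {K : ℝ}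
    (hK : ∀ t ∈ Set.Icc (0 : ℝ) 1, ∀ Γ : ℝ → X, ContinuousOn Γ (Set.Icc 0 t) →
      (∀ s ∈ Set.Icc 0 t, F (Γ s) = γ s) → ∀ s ∈ Set.Icc 0 t, dist (Γ s) (Γ t) ≤ K * (t - s))
    {x : X} (hx : F x = γ 0) :
    ∃ Γ : ℝ → X, ContinuousOn Γ (Set.Icc 0 1) ∧ Γ 0 = x ∧ ∀ s ∈ Set.Icc (0 : ℝ) 1,
      F (Γ s) = γ s := by
  -- The set of times up to which a lift exists.
  let S := {t ∈ Set.Icc (0 : ℝ) 1 | ∃ Γ : ℝ → X, ContinuousOn Γ (Set.Icc 0 t) ∧ Γ 0 = x ∧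
    ∀ s ∈ Set.Icc 0 t, F (Γ s) = γ s}
  have h0S : (0 : ℝ) ∈ S := by
    refine ⟨by simp, fun _ => x, continuousOn_const, rfl, fun s hs => ?_⟩
    rw [hx, le_antisymm hs.2 hs.1]
  have hbdd : BddAbove S := ⟨1, fun t ht => ht.1.2⟩
  set T := sSup S with hT
  have hT0 : 0 ≤ T := le_csSup hbdd h0S
  have hT1 : T ≤ 1 := csSup_le ⟨0, h0S⟩ fun t ht => ht.1.2
  have hchoose : ∀ t, ∃ Γ : ℝ → X, t ∈ S → (ContinuousOn Γ (Set.Icc 0 t) ∧ Γ 0 = x ∧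
      ∀ s ∈ Set.Icc 0 t, F (Γ s) = γ s) := fun t => by
    by_cases ht : t ∈ S
    · obtain ⟨Γ, h⟩ := ht.2
      exact ⟨Γ, fun _ => h⟩
    · exact ⟨fun _ => x, fun h => absurd h ht⟩
  choose Γ hΓ using hchoose
  have hagree : ∀ s ∈ S, ∀ t ∈ S, s ≤ t → Γ s s = Γ t s := by
    intro s hs t ht hst
    refine (T2Space.isSeparatedMap F).eqOn_of_comp_eqOn hF.isLocallyInjective
      isPreconnected_Icc (hΓ s hs).1 ((hΓ t ht).1.mono (Set.Icc_subset_Icc_right hst))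
      (fun r hr => ?_) (Set.left_mem_Icc.2 hs.1.1) ?_ (Set.right_mem_Icc.2 hs.1.1)
    · exact ((hΓ s hs).2.2 r hr).trans ((hΓ t ht).2.2 r ⟨hr.1, hr.2.trans hst⟩).symm
    · rw [(hΓ s hs).2.1, (hΓ t ht).2.1]
  have hlip : ∀ s ∈ S, ∀ t ∈ S, s ≤ t → dist (Γ s s) (Γ t t) ≤ K * (t - s) := by
    intro s hs t ht hst
    rw [hagree s hs t ht hst]
    exact hK t ht.1 _ (hΓ t ht).1 (hΓ t ht).2.2 s ⟨hs.1.1, hst⟩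
  have hTcl : T ∈ closure S := csSup_mem_closure ⟨0, h0S⟩ hbdd
  have hNeBot : (𝓝[S] T).NeBot := mem_closure_iff_nhdsWithin_neBot.1 hTcl
  -- The end points of the lifts converge.
  obtain ⟨m, hm⟩ : ∃ m, Tendsto (fun t => Γ t t) (𝓝[S] T) (𝓝 m) := by
    refine CompleteSpace.complete (Cauchy.map_of_le (s := S)
      (cauchy_nhds.mono nhdsWithin_le_nhds) ?_ inf_le_right)
    have hlip' : LipschitzOnWith K.toNNReal (fun t => Γ t t) S := by
      refine LipschitzOnWith.of_dist_le_mul fun s hs t ht => ?_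
      rcases le_total s t with h | h
      · refine (hlip s hs t ht h).trans ?_
        rw [dist_comm, Real.dist_eq, abs_of_nonneg (sub_nonneg.2 h)]
        exact mul_le_mul_of_nonneg_right (Real.le_coe_toNNReal K) (sub_nonneg.2 h)
      · rw [dist_comm]
        refine (hlip t ht s hs h).trans ?_
        rw [Real.dist_eq, abs_of_nonneg (sub_nonneg.2 h)]
        exact mul_le_mul_of_nonneg_right (Real.le_coe_toNNReal K) (sub_nonneg.2 h)
    exact hlip'.uniformContinuousOn
  have hSsub : S ⊆ Set.Icc 0 1 := fun t ht => ht.1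
  have hFm : F m = γ T := by
    refine tendsto_nhds_unique ((hF.continuous.tendsto m).comp hm) ?_
    refine ((hγ T ⟨hT0, hT1⟩).mono hSsub).congr' ?_
    filter_upwards [self_mem_nhdsWithin] with t ht
    exact ((hΓ t ht).2.2 t (Set.right_mem_Icc.2 ht.1.1)).symm
  obtain ⟨e, hme, rfl⟩ := hF m
  -- The lift is continued by the local inverse of the map at the limit.
  have hev : ∀ᶠ r in 𝓝 T, r ∈ Set.Icc (0 : ℝ) 1 → γ r ∈ e.target := by
    refine eventually_nhdsWithin_iff.1 ((hγ T ⟨hT0, hT1⟩).eventually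
      (e.open_target.mem_nhds ?_))
    rw [← hFm]
    exact e.map_source hme
  obtain ⟨ε, hε, hball⟩ := Metric.eventually_nhds_iff.1 hev
  obtain ⟨s, hs, hsS, hsT⟩ : ∃ s, Γ s s ∈ e.source ∧ s ∈ S ∧ dist s T < ε :=
    ((hm.eventually (e.open_source.mem_nhds hme)).and (Eventually.and
      (eventually_mem_nhdsWithin) (nhdsWithin_le_nhds (Metric.ball_mem_nhds T hε)))).exists
  have hsT' : s ≤ T := le_csSup hbdd hsS
  rw [Real.dist_eq, abs_lt] at hsT
  set T' := min (T + ε / 2) 1 with hT'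
  have hTT' : T ≤ T' := le_min (by linarith) hT1
  have hmem : ∀ r ∈ Set.Icc s T', r ∈ Set.Icc (0 : ℝ) 1 ∧ γ r ∈ e.target := by
    intro r hr
    have h1 : r ∈ Set.Icc (0 : ℝ) 1 := ⟨hsS.1.1.trans hr.1, hr.2.trans (min_le_right _ _)⟩
    refine ⟨h1, hball ?_ h1⟩
    have := hr.2.trans (min_le_left _ _)
    rw [Real.dist_eq, abs_lt]
    constructor <;> linarith [hr.1]
  have hT'S : T' ∈ S := by
    refine ⟨⟨hT0.trans hTT', min_le_right _ _⟩,
      fun r => if r ≤ s then Γ s r else e.symm (γ r), ?_, ?_, ?_⟩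
    · refine ContinuousOn.if ?_ ?_ ?_
      · rintro r ⟨-, hr⟩
        have hrs : r = s := by
          have : r ∈ frontier (Set.Iic s) := hr
          rwa [frontier_Iic] at this
        rw [hrs, ← (hΓ s hsS).2.2 s (Set.right_mem_Icc.2 hsS.1.1), e.left_inv hs]
      · refine (hΓ s hsS).1.mono ?_
        rintro r ⟨hr1, hr2⟩
        have : r ∈ closure (Set.Iic s) := hr2
        rw [closure_Iic] at this
        exact ⟨hr1.1, this⟩
      · have hsub : Set.Icc 0 T' ∩ closure {r | ¬ r ≤ s} ⊆ Set.Icc s T' := by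
          rintro r ⟨hr1, hr2⟩
          have h1 : {r | ¬ r ≤ s} = Set.Ioi s := by ext; simp
          rw [h1, closure_Ioi] at hr2
          exact ⟨hr2, hr1.2⟩
        exact (e.continuousOn_symm.comp (hγ.mono fun r hr => (hmem r hr).1)
          fun r hr => (hmem r hr).2).mono hsub
    · beta_reduce
      rw [if_pos hsS.1.1]
      exact (hΓ s hsS).2.1
    · intro r hr
      beta_reduce
      by_cases hrs : r ≤ s
      · rw [if_pos hrs]
        exact (hΓ s hsS).2.2 r ⟨hr.1, hrs⟩
      · rw [if_neg hrs]
        exact e.right_inv (hmem r ⟨(not_le.1 hrs).le, hr.2⟩).2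
  have h1S : (1 : ℝ) ∈ S := by
    have h1 : T' ≤ T := le_csSup hbdd hT'S
    have h2 : T' = 1 := by
      rcases min_choice (T + ε / 2) 1 with h | h
      · rw [hT', h] at h1
        linarith
      · rw [hT', h]
    rwa [h2] at hT'S
  exact h1S.2

end Covering

/-! ### Homothetic maps from complete manifolds -/

section Completeness

set_option maxSynthPendingDepth 3

open Filter Topology Manifold MeasureTheory
open scoped ENNReal

variable {n : ℕ} {Q : Type*} [TopologicalSpace Q] [ChartedSpace (EuclideanSpace ℝ (Fin n)) Q]
  [IsManifold (𝓡 n) ∞ Q]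
  {M : Type*} [MetricSpace M] [ChartedSpace (EuclideanSpace ℝ (Fin n)) M] [IsManifold (𝓡 n) ∞ M]
  [Bundle.RiemannianBundle (fun x : M => TangentSpace (𝓡 n) x)]
  [IsRiemannianManifold (𝓡 n) M]
  {gQ : Q → EuclideanSpace ℝ (Fin n) →L[ℝ] EuclideanSpace ℝ (Fin n) →L[ℝ] ℝ}
  {F : M → Q} {k : ℝ}

omit [IsManifold (𝓡 n) ∞ M] [IsRiemannianManifold (𝓡 n) M] in
theorem norm_sq_eq_riemannianMetricOf (p : M) (u : TangentSpace (𝓡 n) p) :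
    ‖u‖ ^ 2 = riemannianMetricOf n M p u u :=
  (real_inner_self_eq_norm_sq u).symm

omit [IsManifold (𝓡 n) ∞ Q] [IsManifold (𝓡 n) ∞ M]
  [Bundle.RiemannianBundle (fun x : M => TangentSpace (𝓡 n) x)] [IsRiemannianManifold (𝓡 n) M] in
theorem IsLocalDiffeomorph.contMDiffOn_lift (hF : IsLocalDiffeomorph (𝓡 n) (𝓡 n) ∞ F)
    {γ : ℝ → Q} {Γ : ℝ → M} {s : Set ℝ} (hγ : ContMDiffOn 𝓘(ℝ, ℝ) (𝓡 n) 1 γ s)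
    (hΓ : ContinuousOn Γ s) (h : ∀ r ∈ s, F (Γ r) = γ r) :
    ContMDiffOn 𝓘(ℝ, ℝ) (𝓡 n) 1 Γ s := by
  intro r hr
  obtain ⟨Φ, hΦ, hFΦ⟩ := hF (Γ r)
  have h1 : ContMDiffWithinAt 𝓘(ℝ, ℝ) (𝓡 n) 1 (Φ.symm ∘ γ) s r := by
    refine ContMDiffAt.comp_contMDiffWithinAt r ?_ (hγ r hr)
    refine (Φ.contMDiffOn_invFun.contMDiffAt (Φ.open_target.mem_nhds ?_)).of_le
      (WithTop.coe_le_coe.2 le_top)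
    rw [← h r hr, hFΦ hΦ]
    exact Φ.map_source hΦ
  have h2 : ∀ r' ∈ s, Γ r' ∈ Φ.source → Γ r' = Φ.symm (γ r') := by
    intro r' hr' hs
    rw [← h r' hr', hFΦ hs]
    exact (Φ.left_inv hs).symm
  refine h1.congr_of_eventuallyEq ?_ (h2 r hr hΦ)
  filter_upwards [(hΓ r hr).eventually (Φ.open_source.mem_nhds hΦ), self_mem_nhdsWithin]
    with r' h3 h4 using h2 r' h4 h3

omit [IsManifold (𝓡 n) ∞ Q] [IsManifold (𝓡 n) ∞ M] in
/-- Lifts through a homothetic map are Lipschitz, their speed being a multiple of the speed of the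
path. -/
theorem dist_lift_le (hF : IsLocalDiffeomorph (𝓡 n) (𝓡 n) ∞ F)
    (hk : ∀ (p : M) (u v : EuclideanSpace ℝ (Fin n)), riemannianMetricOf n M p u v
      = k ^ 2 * gQ (F p) (mfderiv (𝓡 n) (𝓡 n) F p u) (mfderiv (𝓡 n) (𝓡 n) F p v))
    {γ : ℝ → Q} (hγ : ContMDiffOn 𝓘(ℝ, ℝ) (𝓡 n) 1 γ (Set.Icc 0 1)) {C : ℝ} (hC : 0 ≤ C)
    (hγC : ∀ r ∈ Set.Icc (0 : ℝ) 1, ∃ D : ℝ →L[ℝ] EuclideanSpace ℝ (Fin n),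
      HasMFDerivWithinAt 𝓘(ℝ, ℝ) (𝓡 n) γ (Set.Icc 0 1) r D ∧ gQ (γ r) (D 1) (D 1) ≤ C ^ 2)
    {t : ℝ} (ht : t ∈ Set.Icc (0 : ℝ) 1) {Γ : ℝ → M} (hΓ : ContinuousOn Γ (Set.Icc 0 t))
    (hFΓ : ∀ s ∈ Set.Icc 0 t, F (Γ s) = γ s) {s : ℝ} (hs : s ∈ Set.Icc 0 t) :
    dist (Γ s) (Γ t) ≤ |k| * C * (t - s) := by
  rcases hs.2.eq_or_lt with rfl | hst
  · simp
  have hsub : Set.Icc s t ⊆ Set.Icc 0 t := Set.Icc_subset_Icc_left hs.1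
  have hsub1 : Set.Icc s t ⊆ Set.Icc 0 1 := Set.Icc_subset_Icc hs.1 ht.2
  have hsm : ContMDiffOn 𝓘(ℝ, ℝ) (𝓡 n) 1 Γ (Set.Icc s t) :=
    hF.contMDiffOn_lift (hγ.mono hsub1) (hΓ.mono hsub) fun r hr => hFΓ r (hsub hr)
  have hspeed : ∀ r ∈ Set.Icc s t,
      ‖mfderivWithin 𝓘(ℝ, ℝ) (𝓡 n) Γ (Set.Icc s t) r 1‖ₑ ≤ ENNReal.ofReal (|k| * C) := by
    intro r hr
    obtain ⟨D, hD, hDC⟩ := hγC r (hsub1 hr)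
    have h1 := ((hsm r hr).mdifferentiableWithinAt one_ne_zero).hasMFDerivWithinAt
    have h2 := (((hF.contMDiff (Γ r)).mdifferentiableAt
      (by simp)).hasMFDerivAt).comp_hasMFDerivWithinAt r h1
    have h3 := h2.congr_of_eventuallyEq (f₁ := γ) (by
      filter_upwards [self_mem_nhdsWithin] with r' hr' using (hFΓ r' (hsub hr')).symm)
      (hFΓ r (hsub hr)).symm
    have h4 := UniqueMDiffWithinAt.eq
      ((uniqueDiffOn_Icc hst).uniqueMDiffOn r hr) (hD.mono hsub1) h3
    rw [← ofReal_norm]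
    refine ENNReal.ofReal_le_ofReal (abs_le_of_sq_le_sq' ?_ (by positivity)).2
    refine (norm_sq_eq_riemannianMetricOf _ _).trans_le ((hk _ _ _).trans_le ?_)
    rw [mul_pow, sq_abs, hFΓ r (hsub hr)]
    refine mul_le_mul_of_nonneg_left ?_ (sq_nonneg k)
    rw [h4] at hDC
    exact hDC
  have hle : edist (Γ s) (Γ t) ≤ ENNReal.ofReal (|k| * C) * ENNReal.ofReal (t - s) := by
    rw [IsRiemannianManifold.out (I := 𝓡 n) (Γ s) (Γ t)]
    refine (riemannianEDist_le_pathELength hsm rfl rfl hst.le).trans ?_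
    rw [pathELength_eq_lintegral_mfderivWithin_Icc]
    refine (setLIntegral_mono' measurableSet_Icc hspeed).trans ?_
    rw [setLIntegral_const, Real.volume_Icc]
  rw [← ENNReal.ofReal_mul (by positivity), edist_dist] at hle
  exact (ENNReal.ofReal_le_ofReal_iff (mul_nonneg (by positivity) (by linarith))).1 hle

omit [IsManifold (𝓡 n) ∞ M] in
/-- Over a small ball of a chart, a homothetic local diffeomorphism from a complete manifold has
sections with arbitrary initial values: the straight segments of the chart are lifted. -/
theorem exists_section_of_complete [T2Space Q] [CompleteSpace M] (hgQ : IsRiemannianMetric gQ)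
    (hF : IsLocalDiffeomorph (𝓡 n) (𝓡 n) ∞ F)
    (hk : ∀ (p : M) (u v : EuclideanSpace ℝ (Fin n)), riemannianMetricOf n M p u v
      = k ^ 2 * gQ (F p) (mfderiv (𝓡 n) (𝓡 n) F p u) (mfderiv (𝓡 n) (𝓡 n) F p v)) (q : Q) :
    ∃ V : Set Q, IsOpen V ∧ q ∈ V ∧ IsPreconnected V ∧ ∀ x (hx : F x ∈ V),
      ∃ σ : V → M, Continuous σ ∧ (∀ v, F (σ v) = v) ∧ σ ⟨F x, hx⟩ = x := by
  set e := extChartAt (𝓡 n) q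
  have hloc := hF.isLocalHomeomorph
  -- On a small ball the metric is bounded.
  obtain ⟨B, hB0, hB⟩ : ∃ B : ℝ, 0 ≤ B ∧ ∀ᶠ z in 𝓝 (e q), ‖chartMetric (𝓡 n) gQ q z‖ ≤ B := by
    have hc : ContinuousAt (chartMetric (𝓡 n) gQ q) (e q) :=
      (hgQ.contDiffOn q).continuousOn.continuousAt (extChartAt_target_mem_nhds q)
    refine ⟨‖chartMetric (𝓡 n) gQ q (e q)‖ + 1, by positivity, ?_⟩
    exact (hc.norm.eventually_lt_const (lt_add_one _)).mono fun z hz => hz.le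
  obtain ⟨r, hr, hball⟩ := Metric.mem_nhds_iff.1
    (inter_mem (extChartAt_target_mem_nhds (I := 𝓡 n) q) hB)
  have htar : Metric.ball (e q) r ⊆ e.target := fun z hz => (hball hz).1
  let V := (chartAt (EuclideanSpace ℝ (Fin n)) q).source ∩ e ⁻¹' Metric.ball (e q) r
  have hVsrc : ∀ v ∈ V, v ∈ e.source := fun v hv => by
    rw [extChartAt_source]
    exact hv.1
  have hVimage : V = e.symm '' Metric.ball (e q) r := by
    ext v
    constructor
    · intro hv
      exact ⟨e v, hv.2, e.left_inv (hVsrc v hv)⟩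
    · rintro ⟨z, hz, rfl⟩
      have h1 := e.map_target (htar hz)
      rw [extChartAt_source] at h1
      refine ⟨h1, ?_⟩
      rw [Set.mem_preimage, e.right_inv (htar hz)]
      exact hz
  refine ⟨V, isOpen_extChartAt_preimage q Metric.isOpen_ball,
    ⟨mem_chart_source _ q, Metric.mem_ball_self hr⟩, ?_, fun x hx => ?_⟩
  · rw [hVimage]
    exact (convex_ball _ _).isPreconnected.image _
      ((continuousOn_extChartAt_symm q).mono htar)
  let line : ℝ → Q → EuclideanSpace ℝ (Fin n) := fun t v => e (F x) + t • (e v - e (F x))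
  have hline : ∀ t ∈ Set.Icc (0 : ℝ) 1, ∀ v ∈ V, line t v ∈ Metric.ball (e q) r := by
    intro t ht v hv
    have := (convex_ball (e q) r).add_smul_sub_mem hx.2 hv.2 ht
    exact this
  have hV : ∀ v ∈ V, ∃ Γ : ℝ → M, ContinuousOn Γ (Set.Icc 0 1) ∧ Γ 0 = x ∧
      ∀ t ∈ Set.Icc (0 : ℝ) 1, F (Γ t) = e.symm (line t v) := by
    intro v hv
    have hsm : ContMDiffOn 𝓘(ℝ, ℝ) (𝓡 n) 1 (fun t => e.symm (line t v)) (Set.Icc 0 1) := by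
      refine ((contMDiffOn_extChartAt_symm (I := 𝓡 n) (n := 1) q).comp (t := e.target)
        (f := fun t => line t v) ?_ fun t ht => htar (hline t ht v hv))
      refine ContMDiff.contMDiffOn (contMDiff_iff_contDiff.2 ?_)
      exact contDiff_const.add (contDiff_id.smul contDiff_const)
    refine hloc.exists_lift_of_lipschitz hsm.continuousOn (K := |k| * (Real.sqrt B * (2 * r)))
      (fun t ht Γ hΓ hFΓ s hs => dist_lift_le hF hk hsm (by positivity) ?_ ht hΓ hFΓ hs) ?_
    · intro t ht
      have hz := hline t ht v hv
      refine ⟨(chartFrame (𝓡 n) q (line t v)).comp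
        (ContinuousLinearMap.toSpanSingleton ℝ (e v - e (F x))), ?_, ?_⟩
      · have h1 : MDifferentiableAt 𝓘(ℝ, EuclideanSpace ℝ (Fin n)) (𝓡 n) e.symm (line t v) := by
          have := mdifferentiableWithinAt_extChartAt_symm (I := 𝓡 n) (htar hz)
          rwa [(𝓡 n).range_eq_univ, mdifferentiableWithinAt_univ] at this
        have h2 : HasFDerivAt (fun t => line t v)
            (ContinuousLinearMap.toSpanSingleton ℝ (e v - e (F x))) t := by
          have := ((hasDerivAt_id t).smul_const (e v - e (F x))).const_add (e (F x))
          rw [one_smul] at this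
          exact this.hasFDerivAt
        exact (HasMFDerivAt.comp t h1.hasMFDerivAt h2.hasMFDerivAt).hasMFDerivWithinAt
      · have hd : ‖e v - e (F x)‖ ≤ 2 * r := by
          have h1 : dist (e v) (e q) < r := hv.2
          have h2 : dist (e (F x)) (e q) < r := hx.2
          rw [← dist_eq_norm]
          linarith [dist_triangle_right (e v) (e (F x)) (e q)]
        simp only [ContinuousLinearMap.comp_apply, ContinuousLinearMap.toSpanSingleton_apply,
          one_smul]
        change chartMetric (𝓡 n) gQ q (line t v) (e v - e (F x)) (e v - e (F x)) ≤ _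
        rw [mul_pow, Real.sq_sqrt hB0, pow_two, ← mul_assoc]
        refine (Real.le_norm_self _).trans ((ContinuousLinearMap.le_opNorm₂ _ _ _).trans ?_)
        have := (hball hz).2
        have h3 : ‖chartMetric (𝓡 n) gQ q (line t v)‖ ≤ B := this
        gcongr
    · simp only [line, zero_smul, add_zero]
      exact (e.left_inv (hVsrc _ hx)).symm
  choose Γ hΓc hΓ0 hΓF using fun v : V => hV v v.2
  -- The lifts depend continuously on the end point.
  let f : C(unitInterval × V, Q) := ⟨fun z => e.symm (line z.1 z.2), by
    refine (continuousOn_extChartAt_symm q).comp_continuous ?_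
      fun z => htar (hline z.1 z.1.2 z.2 z.2.2)
    have he : Continuous fun v : V => e v :=
      (continuousOn_extChartAt q).comp_continuous continuous_subtype_val fun v => hVsrc v v.2
    exact continuous_const.add ((continuous_subtype_val.comp continuous_fst).smul
      ((he.comp continuous_snd).sub continuous_const))⟩
  have hcont : Continuous fun z : unitInterval × V => Γ z.2 z.1 := by
    refine hloc.continuous_lift (T2Space.isSeparatedMap F) f (funext fun z => hΓF z.2 z.1 z.1.2)
      ?_ fun v => (hΓc v).comp_continuous continuous_subtype_val fun t => t.2
    exact continuous_const.congr fun v => (hΓ0 v).symm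
  refine ⟨fun v => Γ v 1, hcont.comp (Continuous.prodMk_right (1 : unitInterval)), fun v => ?_, ?_⟩
  · rw [hΓF v 1 (by simp)]
    simp only [line, one_smul, add_sub_cancel]
    exact e.left_inv (hVsrc v v.2)
  · -- The lift of a constant path is constant.
    have hconst : ∀ t ∈ Set.Icc (0 : ℝ) 1, F (Γ ⟨F x, hx⟩ t) = F x := fun t ht => by
      rw [hΓF _ t ht]
      simp only [line, sub_self, smul_zero, add_zero]
      exact e.left_inv (hVsrc _ hx)
    have := (T2Space.isSeparatedMap F).constOn_of_comp hloc.isLocallyInjective isPreconnected_Icc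
      (hΓc ⟨F x, hx⟩) (fun a ha b hb => (hconst a ha).trans (hconst b hb).symm)
      (Set.right_mem_Icc.2 zero_le_one) (Set.left_mem_Icc.2 zero_le_one)
    exact this.trans (hΓ0 _)

omit [IsManifold (𝓡 n) ∞ M] in
/-- A homothetic local diffeomorphism from a connected complete manifold to a simply connected one
is bijective, being a covering. -/
theorem bijective_of_complete [T2Space Q] [SimplyConnectedSpace Q] [ConnectedSpace M]
    [CompleteSpace M] (hgQ : IsRiemannianMetric gQ)
    (hF : IsLocalDiffeomorph (𝓡 n) (𝓡 n) ∞ F)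
    (hk : ∀ (p : M) (u v : EuclideanSpace ℝ (Fin n)), riemannianMetricOf n M p u v
      = k ^ 2 * gQ (F p) (mfderiv (𝓡 n) (𝓡 n) F p u) (mfderiv (𝓡 n) (𝓡 n) F p v)) :
    Function.Bijective F := by
  have : LocallyPathConnectedSpace Q :=
    ChartedSpace.locallyPathConnectedSpace (EuclideanSpace ℝ (Fin n)) Q
  exact (hF.isLocalHomeomorph.isCoveringMap_of_exists_section
    (exists_section_of_complete hgQ hF hk)).bijective

end Completeness

/-! ### Hypersurfaces of warped products over space forms -/

theorem corollary1 {n : ℕ} (hn : 4 ≤ n) (c : ℝ) (hc : c = -1 ∨ c = 0 ∨ c = 1)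
    -- the space form `Q = ℚⁿ(c)`
    {Q : Type*} [MetricSpace Q] [ChartedSpace (EuclideanSpace ℝ (Fin n)) Q]
    [IsManifold (𝓡 n) ∞ Q]
    [Bundle.RiemannianBundle (fun x : Q => TangentSpace (𝓡 n) x)]
    [IsContMDiffRiemannianBundle (𝓡 n) ∞ (EuclideanSpace ℝ (Fin n))
      (fun x : Q => TangentSpace (𝓡 n) x)]
    [IsRiemannianManifold (𝓡 n) Q] [CompleteSpace Q] [SimplyConnectedSpace Q]
    (hQ : HasConstantCurvatureOn (𝓡 n) (riemannianMetricOf n Q) c Set.univ)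
    -- the open interval `J` and the warping function `f`
    (J : Set ℝ) (hJ : IsOpen J) (hJ' : J.OrdConnected)
    (f : ℝ → ℝ) (hf : ContDiffOn ℝ ∞ f J) (hfpos : ∀ t ∈ J, 0 < f t)
    -- the sectional curvature of `J ×_f Q` is not constant, on any nonempty open subset
    (hnc : ∀ W : Set (ℝ × Q), IsOpen W → W.Nonempty → W ⊆ J ×ˢ Set.univ →
      ¬ ∃ κ : ℝ, HasConstantCurvatureOn (𝓘(ℝ, ℝ).prod (𝓡 n))
        (warpedMetric f (riemannianMetricOf n Q)) κ W)
    -- the connected Riemannian manifold `M`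
    {M : Type*} [MetricSpace M] [ChartedSpace (EuclideanSpace ℝ (Fin n)) M]
    [IsManifold (𝓡 n) ∞ M]
    [Bundle.RiemannianBundle (fun x : M => TangentSpace (𝓡 n) x)]
    [IsContMDiffRiemannianBundle (𝓡 n) ∞ (EuclideanSpace ℝ (Fin n))
      (fun x : M => TangentSpace (𝓡 n) x)]
    [IsRiemannianManifold (𝓡 n) M] [ConnectedSpace M]
    -- `M` is a totally umbilical Einstein hypersurface of `J ×_f Q`
    (χ : M → ℝ × Q)
    (hχ : IsIsometricImmersion (riemannianMetricOf n M)
      (warpedMetric f (riemannianMetricOf n Q)) J χ)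
    (hE : IsEinstein (riemannianMetricOf n M))
    (hU : IsTotallyUmbilical (riemannianMetricOf n M)
      (warpedMetric f (riemannianMetricOf n Q)) χ) :
    (∀ p : M, tangentialPart (riemannianMetricOf n M)
      (warpedMetric f (riemannianMetricOf n Q)) χ p = 0) ∧
    ∃ t₀ ∈ J, (∀ p : M, (χ p).1 = t₀) ∧
      -- the map `M → {t₀} × Q` is a local isometry for the metric `f(t₀)² g_Q`
      IsLocalDiffeomorph (𝓡 n) (𝓡 n) ∞ (fun p : M => (χ p).2) ∧
      (∀ (p : M) (u v : EuclideanSpace ℝ (Fin n)),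
        riemannianMetricOf n M p u v = f t₀ ^ 2 * riemannianMetricOf n Q (χ p).2
          (mfderiv (𝓡 n) (𝓡 n) (fun p : M => (χ p).2) p u)
          (mfderiv (𝓡 n) (𝓡 n) (fun p : M => (χ p).2) p v)) ∧
      -- and an isometry onto the whole slice if `M` is complete
      (CompleteSpace M → Function.Bijective (fun p : M => (χ p).2)) := by
  have hgM := isRiemannianMetric_riemannianMetricOf (n := n) (X := M)
  have hgQ := isRiemannianMetric_riemannianMetricOf (n := n) (X := Q)
  have h0 := hχ.differential_fst_eq_zero_of_not_constant (by omega) hgM hgQ hQ hJ hf hfpos hnc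
    hE hU
  obtain ⟨t₀, ht₀⟩ := exists_height_eq hχ.smooth h0
  have hmetric := hχ.metric_eq_of_height_eq h0 ht₀
  have hloc : IsLocalDiffeomorph (𝓡 n) (𝓡 n) ∞ (fun p : M => (χ p).2) := by
    refine isLocalDiffeomorph_of_injective_mfderiv (contMDiff_snd.comp hχ.smooth) fun p => ?_
    refine (injective_iff_map_eq_zero _).2 fun u hu => ?_
    refine hχ.injective_differential hgM p (Eq.trans (Prod.ext (h0 p u) ?_) (map_zero _).symm)
    exact (mfderiv_snd_comp hχ.smooth p u).symm.trans hu
  have htJ : t₀ ∈ J := ht₀ (Classical.arbitrary M) ▸ hχ.mem _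
  exact ⟨tangentialPart_eq_zero h0, t₀, htJ, ht₀, hloc, hmetric,
    fun _ => bijective_of_complete hgQ hloc hmetric⟩
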